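/- For $t\in\mathbb R$, $x\in[0,1]$ consider the problem for $u=(u_1,u_2)$ $$ (\ast)\qquad \begin{aligned} &\partial_tu_j(t,x)+a_j(x)\,\partial_xu_j(t,x)=f_j(x,u(t,x)),\quad j=1,2,\\ &u_1(t,0)=r_1u_2(t,0),\qquad u_2(t,1)=r_2u_1(t,1),\\ &u(t+1,x)=u(t,x), \end{aligned} $$ where for $j=1,2$: $a_j\in C([0,1])$, $r_j\in\mathbb R$, $a_j(x)\neq0$ and $a_1(x)\neq a_2(x)$ for all $x\in[0,1]$, and the partial derivatives $\partial_{u_1}^k\partial_{u_2}^lf_j$ exist and belong to $C([0,1]\times\mathbb R^2)$ for all integers $k,l\ge 0$. Put $\alpha_j(x,y):=\int_x^y\frac{dz}{a_j(z)}$. **Theorem 1.1.** Let $u\in C(\mathbb R\times[0,1];\mathbb R^2)$ satisfy at least one of the two conditions $$ \int_0^1\left(\frac{\partial_{u_1}f_1(x,u(t-\alpha_1(x,1),x))}{a_1(x)}-\frac{\partial_{u_2}f_2(x,u(t-\alpha_2(x,1),x))}{a_2(x)}\right)dx\neq-\ln|r_1r_2|\quad\text{for all }t\in\mathbb R, $$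 $$ \int_0^1\left(\frac{\partial_{u_1}f_1(x,u(t+\alpha_1(0,x),x))}{a_1(x)}-\frac{\partial_{u_2}f_2(x,u(t+\alpha_2(0,x),x))}{a_2(x)}\right)dx\neq-\ln|r_1r_2|\quad\text{for all }t\in\mathbb R, $$ where $\ln 0:=-\infty$, so that both conditions hold if $r_1r_2=0$. Then: (i) Suppose that $u$ satisfies the boundary and periodicity conditions in $(\ast)$ and that there are $u^1,u^2,\ldots\in C^1(\mathbb R\times[0,1];\mathbb R^2)$ such that, for $j=1,2$, $$ |u^n_j(t,x)-u_j(t,x)|+|\partial_tu^n_j(t,x)+a_j(x)\partial_xu^n_j(t,x)-f_j(x,u(t,x))|\to0\quad\text{as }n\to\infty $$ uniformly in $(t,x)\in\mathbb R\times[0,1]$. Then $u$ is a classical solution of $(\ast)$, in particular $u$ is $C^1$. Moreover, all partial derivatives $\partial_t^ku$, $k\in\mathbb N$, exist and belong to $C(\mathbb R\times[0,1];\mathbb R^2)$. (ii) If $u$ is a classical ($C^1$) solution of $(\ast)$, and the functions $a_j$ (on $[0,1]$) and $f_j$ (on $[0,1]\times\mathbb R^2$), $j=1,2$, are $C^\infty$,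 then $u$ is $C^\infty$ on $\mathbb R\times[0,1]$. -/

import Mathlib

open Set Filter Topology MeasureTheory
open scoped ContDiff

/-! The two equations are indexed by `Fin 2`: the indices `1, 2` of the mathematics are `0, 1` here.
A pair `u = (u₁, u₂)` of functions of `(t, x)` is `u : Fin 2 → ℝ × ℝ → ℝ`; only its values on the
strip `ℝ × [0, 1]` matter. The nonlinearity `f_j` is a function of `(x, u₁, u₂)`. -/

noncomputable section

namespace HypSys

/-- The strip `ℝ × [0, 1]` of all `(t, x)`. -/
def strip : Set (ℝ × ℝ) := univ ×ˢ Icc (0 : ℝ) 1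

/-- The domain `[0, 1] × ℝ²` of all `(x, u₁, u₂)`. -/
def fdom : Set (ℝ × ℝ × ℝ) := Icc (0 : ℝ) 1 ×ˢ univ

/-- The partial derivative `∂_t v`. -/
def dt (v : ℝ × ℝ → ℝ) (p : ℝ × ℝ) : ℝ := deriv (fun t => v (t, p.2)) p.1

/-- The partial derivative `∂_x v` on the strip (one-sided at `x = 0` and `x = 1`). -/
def dx (v : ℝ × ℝ → ℝ) (p : ℝ × ℝ) : ℝ := derivWithin (fun x => v (p.1, x)) (Icc 0 1) p.2

/-- The partial derivative of `g (x, u₁, u₂)` with respect to `u₁`. -/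
def du₁ (g : ℝ × ℝ × ℝ → ℝ) (q : ℝ × ℝ × ℝ) : ℝ := deriv (fun s => g (q.1, s, q.2.2)) q.2.1

/-- The partial derivative of `g (x, u₁, u₂)` with respect to `u₂`. -/
def du₂ (g : ℝ × ℝ × ℝ → ℝ) (q : ℝ × ℝ × ℝ) : ℝ := deriv (fun s => g (q.1, q.2.1, s)) q.2.2

/-- All partial derivatives `∂_{u₁}^k ∂_{u₂}^l g`, `k, l ≥ 0`, exist on `[0, 1] × ℝ²` and are
continuous there. -/
structure SmoothInU (g : ℝ × ℝ × ℝ → ℝ) : Prop where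
  exists_du₂ : ∀ l : ℕ, ∀ x ∈ Icc (0 : ℝ) 1, ∀ v₁ v₂ : ℝ,
    DifferentiableAt ℝ (fun s => (du₂^[l] g) (x, v₁, s)) v₂
  exists_du₁ : ∀ k l : ℕ, ∀ x ∈ Icc (0 : ℝ) 1, ∀ v₁ v₂ : ℝ,
    DifferentiableAt ℝ (fun s => (du₁^[k] (du₂^[l] g)) (x, s, v₂)) v₁
  continuousOn : ∀ k l : ℕ, ContinuousOn (du₁^[k] (du₂^[l] g)) fdom

/-- `α(x, y) = ∫_x^y dz / a(z)`. -/
def alpha (a : ℝ → ℝ) (x y : ℝ) : ℝ := ∫ z in x..y, 1 / a z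

/-- The point `(x, u(t, x))` at which the nonlinearities are evaluated. -/
def jet (u : Fin 2 → ℝ × ℝ → ℝ) (p : ℝ × ℝ) : ℝ × ℝ × ℝ := (p.2, u 0 p, u 1 p)

/-- `∫_0^1 (∂_{u₁}f₁(x, u(t - α₁(x,1), x)) / a₁(x) - ∂_{u₂}f₂(x, u(t - α₂(x,1), x)) / a₂(x)) dx`. -/
def resIntegralOne (a : Fin 2 → ℝ → ℝ) (f : Fin 2 → ℝ × ℝ × ℝ → ℝ)
    (u : Fin 2 → ℝ × ℝ → ℝ) (t : ℝ) : ℝ :=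
  ∫ x in (0 : ℝ)..1,
    (du₁ (f 0) (jet u (t - alpha (a 0) x 1, x)) / a 0 x
      - du₂ (f 1) (jet u (t - alpha (a 1) x 1, x)) / a 1 x)

/-- `∫_0^1 (∂_{u₁}f₁(x, u(t + α₁(0,x), x)) / a₁(x) - ∂_{u₂}f₂(x, u(t + α₂(0,x), x)) / a₂(x)) dx`. -/
def resIntegralZero (a : Fin 2 → ℝ → ℝ) (f : Fin 2 → ℝ × ℝ × ℝ → ℝ)
    (u : Fin 2 → ℝ × ℝ → ℝ) (t : ℝ) : ℝ :=
  ∫ x in (0 : ℝ)..1,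
    (du₁ (f 0) (jet u (t + alpha (a 0) 0 x, x)) / a 0 x
      - du₂ (f 1) (jet u (t + alpha (a 1) 0 x, x)) / a 1 x)

/-- `I(t) ≠ -ln |r₁ r₂|` for all `t`, with the convention `ln 0 = -∞`: the condition is void if
`r₁ r₂ = 0`. -/
def NonResonant (r₁ r₂ : ℝ) (I : ℝ → ℝ) : Prop :=
  r₁ * r₂ ≠ 0 → ∀ t : ℝ, I t ≠ -Real.log |r₁ * r₂|

/-- The boundary conditions `u₁(t, 0) = r₁ u₂(t, 0)`, `u₂(t, 1) = r₂ u₁(t, 1)`. -/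
def BoundaryCond (r₁ r₂ : ℝ) (u : Fin 2 → ℝ × ℝ → ℝ) : Prop :=
  ∀ t : ℝ, u 0 (t, 0) = r₁ * u 1 (t, 0) ∧ u 1 (t, 1) = r₂ * u 0 (t, 1)

/-- 1-periodicity in `t`. -/
def TimePeriodic (u : Fin 2 → ℝ × ℝ → ℝ) : Prop :=
  ∀ j : Fin 2, ∀ t : ℝ, ∀ x ∈ Icc (0 : ℝ) 1, u j (t + 1, x) = u j (t, x)

/-- There are `C¹` functions `uⁿ` such that
`|uⁿ_j - u_j| + |∂_t uⁿ_j + a_j ∂_x uⁿ_j - f_j(x, u)| → 0` uniformly on the strip, `j = 1, 2`. -/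
def IsClosureSolution (a : Fin 2 → ℝ → ℝ) (f : Fin 2 → ℝ × ℝ × ℝ → ℝ)
    (u : Fin 2 → ℝ × ℝ → ℝ) : Prop :=
  ∃ w : ℕ → Fin 2 → ℝ × ℝ → ℝ,
    (∀ n j, ContDiffOn ℝ 1 (w n j) strip) ∧
    ∀ j, TendstoUniformlyOn
      (fun n p => |w n j p - u j p| +
        |dt (w n j) p + a j p.2 * dx (w n j) p - f j (jet u p)|)
      (fun _ => 0) atTop strip

/-- Classical solutions of the boundary value problem: `C¹` on the strip, and all equations hold
pointwise. -/
structure IsClassicalSolution (a : Fin 2 → ℝ → ℝ) (f : Fin 2 → ℝ × ℝ × ℝ → ℝ) (r₁ r₂ : ℝ)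
    (u : Fin 2 → ℝ × ℝ → ℝ) : Prop where
  contDiffOn : ∀ j, ContDiffOn ℝ 1 (u j) strip
  equation : ∀ j, ∀ p ∈ strip, dt (u j) p + a j p.2 * dx (u j) p = f j (jet u p)
  boundary : BoundaryCond r₁ r₂ u
  periodic : TimePeriodic u

/-- All partial derivatives `∂_t^k v` exist on the strip and are (jointly) continuous there. -/
def SmoothInTime (v : ℝ × ℝ → ℝ) : Prop :=
  ∀ k : ℕ, (∀ x ∈ Icc (0 : ℝ) 1, ContDiff ℝ k (fun t => v (t, x))) ∧
    ContinuousOn (fun p : ℝ × ℝ => iteratedDeriv k (fun t => v (t, p.2)) p.1) strip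

end HypSys

end

noncomputable section

namespace HypSys

/-! Everything is integrated along characteristics (`CharSol`). This form makes sense for merely
continuous functions and survives limits (`CharSol.of_tendsto`), so generalized and classical
solutions are treated alike. All functions are extended to the whole plane by clamping `x`; together
with periodicity in time this gives uniform bounds and uniform continuity for free.

The core is the a priori bound `LinSol.estimate` for the linear problem with coefficients `b`: the
sup norm of a solution is controlled by the sup norm of the source and by a weak norm, the sup of
the time primitives of the solution. Two mechanisms produce it. Along a characteristic of one
family, the diagonal coefficient contributes an exponential factor, while the other component enters
only through an integral. That component varies slowly along its own characteristics, and these are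
transversal to the first family because the speeds differ. On short pieces the integral therefore
turns into a time primitive, with error a small multiple of the sup norm (`averaging`,
`transport_estimate`). What remains is pure transport and reflection, a relation `w(t + p) = c(t)
w(t + q) + O(D)` with `c = r₁ r₂ exp(I)`. Non-resonance says `|c| ≠ 1`; by continuity and
periodicity `|c|` stays uniformly below or uniformly above `1`, so the relation is contracting in
one direction or the other (`abs_le_of_transport`, `boundary_estimate`). The small multiple of the
sup norm is then absorbed.

Difference quotients of `u` in time solve such a linear problem, with coefficients `∂_{u_k} f_j` and
a small source. Their time primitives are differences of short averages of `u`, hence bounded and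
uniformly convergent. The bound makes the quotients bounded, and applied to their differences it
makes them uniformly Cauchy (`exists_time_deriv`). The derivative solves the linearized problem,
whose coefficients, and hence whose non-resonance condition, do not change under further
differentiation, so all time derivatives follow (`LinSol.timeReg`, `timeReg_of_charSol`).
Derivatives in `x` are recovered from the equation, `∂_x u = (f - ∂_t u) / a`: once for `C¹`,
repeatedly for `C^∞` (`contDiffOn_of_charSol`). -/

/-- The nearest-point projection of `ℝ` onto `[0, 1]`. -/
def clamp (x : ℝ) : ℝ := (projIcc (0 : ℝ) 1 zero_le_one x : ℝ)

lemma continuous_clamp : Continuous clamp := continuous_subtype_val.comp continuous_projIcc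

lemma clamp_mem (x : ℝ) : clamp x ∈ Icc (0 : ℝ) 1 := (projIcc (0 : ℝ) 1 zero_le_one x).2

lemma clamp_of_mem {x : ℝ} (hx : x ∈ Icc (0 : ℝ) 1) : clamp x = x := by
  simp [clamp, projIcc_of_mem zero_le_one hx]

lemma clamp_clamp (x : ℝ) : clamp (clamp x) = clamp x := clamp_of_mem (clamp_mem x)

/-! ### Uniform bounds for time-periodic functions -/

/-- Continuous functions of `(t, x)`, 1-periodic in `t`. -/
structure ContPer (F : ℝ × ℝ → ℝ) : Prop where
  cont : Continuous F
  per : ∀ t x, F (t + 1, x) = F (t, x)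

/-- Continuous functions of `(t, x)`, 1-periodic in `t`, that depend on `x` only through
`clamp x`. -/
structure Per (F : ℝ × ℝ → ℝ) : Prop extends ContPer F where
  clamp : ∀ t x, F (t, clamp x) = F (t, x)

lemma ContPer.sub_floor {F : ℝ × ℝ → ℝ} (hF : ContPer F) (t x : ℝ) (n : ℤ) :
    F (t - n, x) = F (t, x) := by
  have h : Function.Periodic (fun t => F (t, x)) 1 := fun t => hF.per t x
  simpa using h.sub_int_mul_eq (x := t) n

lemma ContPer.bounded {F : ℝ × ℝ → ℝ} (hF : ContPer F) :
    ∃ K > 0, ∀ t, ∀ x ∈ Icc (0 : ℝ) 1, |F (t, x)| ≤ K := by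
  obtain ⟨K, hK⟩ := ((isCompact_Icc (a := (0 : ℝ)) (b := 1)).prod
    (isCompact_Icc (a := (0 : ℝ)) (b := 1))).exists_bound_of_continuousOn hF.cont.continuousOn
  refine ⟨max K 1, by positivity, fun t x hx => ?_⟩
  rw [← hF.sub_floor t x ⌊t⌋]
  exact (hK (t - ⌊t⌋, x) ⟨⟨by linarith [Int.floor_le t], by linarith [Int.lt_floor_add_one t]⟩,
    hx⟩).trans (le_max_left _ _)

lemma ContPer.unif {F : ℝ × ℝ → ℝ} (hF : ContPer F) {ε : ℝ} (hε : 0 < ε) :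
    ∃ δ > 0, ∀ t t', ∀ x ∈ Icc (0 : ℝ) 1, ∀ x' ∈ Icc (0 : ℝ) 1, |t - t'| < δ → |x - x'| < δ →
      |F (t, x) - F (t', x')| < ε := by
  -- Shifting by `⌊t⌋` brings `t` into `[0, 1)`, and then a point `t'` at distance below `1` lies in
  -- `[-1, 2]`.
  have hc := ((isCompact_Icc (a := (-1 : ℝ)) (b := 2)).prod
    (isCompact_Icc (a := (0 : ℝ)) (b := 1))).uniformContinuousOn_of_continuous hF.cont.continuousOn
  obtain ⟨δ, hδ, h⟩ := Metric.uniformContinuousOn_iff.1 hc ε hε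
  refine ⟨min δ 1, by positivity, fun t t' x hx x' hx' ht hxx => ?_⟩
  have h0 := Int.floor_le t
  have h1 := Int.lt_floor_add_one t
  have h2 := abs_lt.1 (ht.trans_le (min_le_right _ _))
  have := h (t - ⌊t⌋, x) ⟨⟨by linarith, by linarith⟩, hx⟩ (t' - ⌊t⌋, x')
    ⟨⟨by linarith, by linarith⟩, hx'⟩ (by
      rw [Prod.dist_eq, Real.dist_eq, Real.dist_eq, max_lt_iff]
      refine ⟨?_, hxx.trans_le (min_le_left _ _)⟩
      rw [sub_sub_sub_cancel_right]
      exact ht.trans_le (min_le_left _ _))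
  rwa [hF.sub_floor, hF.sub_floor, Real.dist_eq] at this

lemma ContPer.add {F G : ℝ × ℝ → ℝ} (hF : ContPer F) (hG : ContPer G) :
    ContPer (fun p => F p + G p) :=
  ⟨hF.cont.add hG.cont, fun t x => by rw [hF.per, hG.per]⟩

lemma ContPer.mul {F G : ℝ × ℝ → ℝ} (hF : ContPer F) (hG : ContPer G) :
    ContPer (fun p => F p * G p) :=
  ⟨hF.cont.mul hG.cont, fun t x => by rw [hF.per, hG.per]⟩

/-- Clamping reduces `x` to a compact interval, so the bound holds on the whole plane and not only
on the strip. -/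
lemma Per.bounded {F : ℝ × ℝ → ℝ} (hF : Per F) : ∃ K > 0, ∀ p, |F p| ≤ K := by
  obtain ⟨K, hK, h⟩ := hF.toContPer.bounded
  exact ⟨K, hK, fun p => by rw [← hF.clamp p.1 p.2]; exact h _ _ (clamp_mem _)⟩

lemma Per.unif_time {F : ℝ × ℝ → ℝ} (hF : Per F) {ε : ℝ} (hε : 0 < ε) :
    ∃ δ > 0, ∀ t t' x, |t - t'| < δ → |F (t, x) - F (t', x)| < ε := by
  obtain ⟨δ, hδ, h⟩ := hF.toContPer.unif hε
  refine ⟨δ, hδ, fun t t' x ht => ?_⟩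
  rw [← hF.clamp t, ← hF.clamp t']
  exact h _ _ _ (clamp_mem _) _ (clamp_mem _) ht (by simpa using hδ)

lemma Per.add {F G : ℝ × ℝ → ℝ} (hF : Per F) (hG : Per G) : Per (fun p => F p + G p) :=
  ⟨hF.toContPer.add hG.toContPer, fun t x => by rw [hF.clamp, hG.clamp]⟩

lemma Per.mul {F G : ℝ × ℝ → ℝ} (hF : Per F) (hG : Per G) : Per (fun p => F p * G p) :=
  ⟨hF.toContPer.mul hG.toContPer, fun t x => by rw [hF.clamp, hG.clamp]⟩

lemma Per.const (c : ℝ) : Per (fun _ => c) := ⟨⟨continuous_const, fun _ _ => rfl⟩, fun _ _ => rfl⟩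

lemma Per.const_mul {F : ℝ × ℝ → ℝ} (hF : Per F) (c : ℝ) : Per (fun p => c * F p) :=
  (Per.const c).mul hF

lemma Per.sub {F G : ℝ × ℝ → ℝ} (hF : Per F) (hG : Per G) : Per (fun p => F p - G p) := by
  simpa [sub_eq_add_neg] using hF.add (hG.const_mul (-1))

lemma Per.shift {F : ℝ × ℝ → ℝ} (hF : Per F) (h : ℝ) : Per (fun p => F (p.1 + h, p.2)) :=
  ⟨⟨hF.cont.comp (by fun_prop), fun t x => by
    change F (t + 1 + h, x) = _; rw [add_right_comm, hF.per]⟩, fun t x => hF.clamp _ _⟩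

lemma Per.sum {ι : Type*} (s : Finset ι) {F : ι → ℝ × ℝ → ℝ} (hF : ∀ i ∈ s, Per (F i)) :
    Per (fun p => ∑ i ∈ s, F i p) :=
  ⟨⟨continuous_finsetSum _ fun i hi => (hF i hi).cont,
    fun t x => Finset.sum_congr rfl fun i hi => (hF i hi).per t x⟩,
    fun t x => Finset.sum_congr rfl fun i hi => (hF i hi).clamp t x⟩

/-! ### Characteristics and equations integrated along them -/

/-- The primitive of `ρ` that vanishes at `0`. -/
def prim (ρ : ℝ → ℝ) (x : ℝ) : ℝ := ∫ y in (0 : ℝ)..x, ρ y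

lemma prim_zero (ρ : ℝ → ℝ) : prim ρ 0 = 0 := intervalIntegral.integral_same

lemma hasDerivAt_prim {ρ : ℝ → ℝ} (hρ : Continuous ρ) (x : ℝ) : HasDerivAt (prim ρ) (ρ x) x :=
  intervalIntegral.integral_hasDerivAt_right (hρ.intervalIntegrable _ _)
    hρ.aestronglyMeasurable.stronglyMeasurableAtFilter hρ.continuousAt

lemma continuous_prim {ρ : ℝ → ℝ} (hρ : Continuous ρ) : Continuous (prim ρ) :=
  continuous_iff_continuousAt.2 fun x => (hasDerivAt_prim hρ x).continuousAt

/-- `F` along the characteristics, parametrized by the time at which they pass `x = 0`. -/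
def along (ρ : ℝ → ℝ) (F : ℝ × ℝ → ℝ) (p : ℝ × ℝ) : ℝ := F (p.1 + prim ρ p.2, p.2)

lemma continuous_along {ρ : ℝ → ℝ} (hρ : Continuous ρ) {F : ℝ × ℝ → ℝ} (hF : Continuous F) :
    Continuous (along ρ F) := by
  have := continuous_prim hρ
  unfold along
  fun_prop

lemma ContPer.along {ρ : ℝ → ℝ} (hρ : Continuous ρ) {F : ℝ × ℝ → ℝ} (hF : ContPer F) :
    ContPer (along ρ F) :=
  ⟨continuous_along hρ hF.cont, fun t x => by simp only [HypSys.along]; rw [add_right_comm, hF.per]⟩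

/-- `v` solves `∂_t v + a ∂_x v = h`, integrated along the characteristics, where `ρ = 1 / a`. -/
def CharSol (ρ : ℝ → ℝ) (v h : ℝ × ℝ → ℝ) : Prop :=
  ∀ t, ∀ x ∈ Icc (0 : ℝ) 1,
    v (t + prim ρ x, x) = v (t, 0) + ∫ y in (0 : ℝ)..x, ρ y * h (t + prim ρ y, y)

/-- The speeds do not depend on time, so time translation carries characteristics to
characteristics. -/
lemma CharSol.shift {ρ : ℝ → ℝ} {v h : ℝ × ℝ → ℝ} (H : CharSol ρ v h) (s : ℝ) :
    CharSol ρ (fun p => v (p.1 + s, p.2)) (fun p => h (p.1 + s, p.2)) := by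
  intro t x hx
  have := H (t + s) x hx
  simp only [add_right_comm t s] at this
  exact this

lemma CharSol.congr {ρ : ℝ → ℝ} {v h v' h' : ℝ × ℝ → ℝ} (H : CharSol ρ v h)
    (hv : ∀ t, ∀ x ∈ Icc (0 : ℝ) 1, v (t, x) = v' (t, x))
    (hh : ∀ t, ∀ x ∈ Icc (0 : ℝ) 1, h (t, x) = h' (t, x)) : CharSol ρ v' h' := by
  intro t x hx
  rw [← hv _ _ hx, ← hv _ _ (left_mem_Icc.2 zero_le_one), H t x hx]
  congr 1
  refine intervalIntegral.integral_congr fun y hy => ?_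
  rw [uIcc_of_le hx.1] at hy
  rw [hh _ _ ⟨hy.1, hy.2.trans hx.2⟩]

lemma continuous_along_mul {ρ : ℝ → ℝ} (hρ : Continuous ρ) {h : ℝ × ℝ → ℝ} (hh : Continuous h)
    (t : ℝ) : Continuous fun y => ρ y * h (t + prim ρ y, y) := by
  have := continuous_prim hρ
  fun_prop

lemma CharSol.linComb {ρ : ℝ → ℝ} (hρ : Continuous ρ) {v h v' h' : ℝ × ℝ → ℝ} (H : CharSol ρ v h)
    (H' : CharSol ρ v' h') (hh : Continuous h) (hh' : Continuous h') (c c' : ℝ) :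
    CharSol ρ (fun p => c * v p + c' * v' p) (fun p => c * h p + c' * h' p) := by
  intro t x hx
  simp only [H t x hx, H' t x hx]
  have e : ∀ y, ρ y * (c * h (t + prim ρ y, y) + c' * h' (t + prim ρ y, y)) =
      c * (ρ y * h (t + prim ρ y, y)) + c' * (ρ y * h' (t + prim ρ y, y)) := fun y => by ring
  simp only [e]
  rw [intervalIntegral.integral_add, intervalIntegral.integral_const_mul,
    intervalIntegral.integral_const_mul]
  · ring
  · exact ((continuous_along_mul hρ hh t).const_mul c).intervalIntegrable _ _
  · exact ((continuous_along_mul hρ hh' t).const_mul c').intervalIntegrable _ _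

/-- Integrated solutions are stable under pointwise limits of the solution and uniform limits of
the right-hand side. -/
lemma CharSol.of_tendsto {ι : Type*} {l : Filter ι} [l.NeBot] {ρ : ℝ → ℝ} (hρ : Continuous ρ)
    {V H : ι → ℝ × ℝ → ℝ} {v h : ℝ × ℝ → ℝ} (hH : ∀ᶠ i in l, ContinuousOn (H i) strip)
    (hh : Continuous h)
    (hsol : ∀ᶠ i in l, CharSol ρ (V i) (H i))
    (hV : ∀ t, ∀ x ∈ Icc (0 : ℝ) 1, Tendsto (fun i => V i (t, x)) l (𝓝 (v (t, x))))
    (hHh : TendstoUniformlyOn H h l strip) : CharSol ρ v h := by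
  intro t x hx
  have h1 := hV (t + prim ρ x) x hx
  have h2 := hV t 0 (left_mem_Icc.2 zero_le_one)
  obtain ⟨R, hR⟩ := (isCompact_Icc (a := (0 : ℝ)) (b := 1)).exists_bound_of_continuousOn
    hρ.continuousOn
  have hR0 : 0 ≤ R := (norm_nonneg _).trans (hR 0 (left_mem_Icc.2 zero_le_one))
  have h3 : Tendsto (fun i => ∫ y in (0 : ℝ)..x, ρ y * H i (t + prim ρ y, y)) l
      (𝓝 (∫ y in (0 : ℝ)..x, ρ y * h (t + prim ρ y, y))) := by
    rw [Metric.tendsto_nhds]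
    intro ε hε
    have hε' : 0 < ε / (2 * (R + 1)) := by positivity
    filter_upwards [hH, Metric.tendstoUniformlyOn_iff.1 hHh _ hε'] with i hi hi'
    have hc : ContinuousOn (fun y => ρ y * H i (t + prim ρ y, y)) (uIcc 0 x) := by
      refine hρ.continuousOn.mul (hi.comp ?_ ?_)
      · have := continuous_prim hρ
        fun_prop
      · intro y hy
        rw [uIcc_of_le hx.1] at hy
        exact ⟨mem_univ _, hy.1, hy.2.trans hx.2⟩
    rw [Real.dist_eq, ← intervalIntegral.integral_sub hc.intervalIntegrable
      ((continuous_along_mul hρ hh t).intervalIntegrable _ _)]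
    have := intervalIntegral.norm_integral_le_of_norm_le_const (a := (0 : ℝ)) (b := x)
      (f := fun y => ρ y * H i (t + prim ρ y, y) - ρ y * h (t + prim ρ y, y))
      (C := R * (ε / (2 * (R + 1)))) (fun y hy => by
        rw [uIoc_of_le hx.1] at hy
        have hy' : y ∈ Icc (0 : ℝ) 1 := ⟨hy.1.le, hy.2.trans hx.2⟩
        rw [← mul_sub, norm_mul]
        refine mul_le_mul (hR y hy') ?_ (norm_nonneg _) hR0
        have := hi' (t + prim ρ y, y) ⟨mem_univ _, hy'⟩
        rw [dist_comm, Real.dist_eq] at this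
        exact this.le)
    rw [Real.norm_eq_abs] at this
    refine this.trans_lt ?_
    rw [sub_zero, abs_of_nonneg hx.1]
    have h4 : R * (ε / (2 * (R + 1))) * x ≤ R * (ε / (2 * (R + 1))) :=
      mul_le_of_le_one_right (by positivity) hx.2
    refine h4.trans_lt ?_
    rw [← mul_div_assoc, div_lt_iff₀ (by positivity)]
    nlinarith
  exact tendsto_nhds_unique (h1.congr' (hsol.mono fun i hi => hi t x hx)) (h2.add h3)

/-! ### Averaging along transversal curves -/

/-- The averaging estimate on one subinterval. -/
lemma abs_integral_piece_le {κ σ σ' : ℝ → ℝ} {ψ : ℝ × ℝ → ℝ} (hκ : Continuous κ)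
    (hσ' : Continuous σ') (hσ : ∀ y, HasDerivAt σ (σ' y) y) (hψ : Continuous ψ)
    {p q S K N W η ℓ : ℝ} (hpq : p ≤ q) (hS : ∀ y ∈ Icc p q, |σ' y| ≤ S)
    (hK : ∀ y ∈ Icc p q, |κ y| ≤ K) (hη : ∀ y ∈ Icc p q, |κ y - κ p| ≤ η)
    (hN : ∀ s, |ψ (s, p)| ≤ N) (hℓ : ∀ s, ∀ y ∈ Icc p q, |ψ (s, y) - ψ (s, p)| ≤ ℓ)
    (hW : ∀ s s', |∫ r in s..s', ψ (r, p)| ≤ W) :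
    |∫ y in p..q, κ y * σ' y * ψ (σ y, y)| ≤ S * (K * ℓ + η * N) * (q - p) + K * W := by
  have hp : p ∈ Icc p q := left_mem_Icc.2 hpq
  have hσc : Continuous σ := continuous_iff_continuousAt.2 fun x => (hσ x).continuousAt
  have hK0 : 0 ≤ K := (abs_nonneg _).trans (hK p hp)
  have hη0 : 0 ≤ η := (abs_nonneg _).trans (hη p hp)
  have hS0 : 0 ≤ S := (abs_nonneg _).trans (hS p hp)
  -- Freezing `κ` and the second argument of `ψ` at the left endpoint leaves an integrand in which
  -- `r = σ y` can be substituted; the result is a time primitive, bounded by `W`.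
  have hsub : ∫ y in p..q, κ p * (ψ (σ y, p) * σ' y) = κ p * ∫ r in σ p..σ q, ψ (r, p) := by
    rw [intervalIntegral.integral_const_mul]
    congr 1
    exact intervalIntegral.integral_comp_mul_deriv (g := fun r => ψ (r, p)) (fun x _ => hσ x)
      hσ'.continuousOn (by fun_prop)
  have hsplit : ∫ y in p..q, κ y * σ' y * ψ (σ y, y) =
      (∫ y in p..q, (κ y * σ' y * ψ (σ y, y) - κ p * (ψ (σ y, p) * σ' y))) +
        κ p * ∫ r in σ p..σ q, ψ (r, p) := by
    rw [← hsub, ← intervalIntegral.integral_add]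
    · simp
    · exact Continuous.intervalIntegrable (by fun_prop) _ _
    · exact Continuous.intervalIntegrable (by fun_prop) _ _
  rw [hsplit]
  refine (abs_add_le _ _).trans (add_le_add ?_ ?_)
  · have := intervalIntegral.norm_integral_le_of_norm_le_const (a := p) (b := q)
      (f := fun y => κ y * σ' y * ψ (σ y, y) - κ p * (ψ (σ y, p) * σ' y))
      (C := S * (K * ℓ + η * N)) (fun y hy => by
        rw [uIoc_of_le hpq] at hy
        have hy' : y ∈ Icc p q := ⟨hy.1.le, hy.2⟩
        have e : κ y * σ' y * ψ (σ y, y) - κ p * (ψ (σ y, p) * σ' y) =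
          σ' y * (κ y * (ψ (σ y, y) - ψ (σ y, p)) + (κ y - κ p) * ψ (σ y, p)) := by ring
        rw [e, Real.norm_eq_abs, abs_mul]
        refine mul_le_mul (hS y hy') ((abs_add_le _ _).trans ?_) (abs_nonneg _) hS0
        rw [abs_mul, abs_mul]
        exact add_le_add (mul_le_mul (hK y hy') (hℓ _ y hy') (abs_nonneg _) hK0)
          (mul_le_mul (hη y hy') (hN _) (abs_nonneg _) hη0))
    rwa [abs_of_nonneg (sub_nonneg.2 hpq), Real.norm_eq_abs] at this
  · rw [abs_mul]
    exact mul_le_mul (hK p hp) (hW _ _) (abs_nonneg _) hK0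

/-- Averaging along a curve that is transversal to the `x`-direction: the weak bound `W` on `ψ`
controls the integral up to an arbitrarily small multiple of the strong bounds `N` and `L`. -/
lemma averaging {κ : ℝ × ℝ → ℝ} (hκ : ContPer κ) {σ σ' : ℝ → ℝ} (hσ' : Continuous σ')
    (hσ : ∀ y, HasDerivAt σ (σ' y) y) {ε : ℝ} (hε : 0 < ε) :
    ∃ C > 0, ∀ (ψ : ℝ × ℝ → ℝ) (N L W : ℝ), Continuous ψ → 0 ≤ N → 0 ≤ L → 0 ≤ W →
      (∀ s, ∀ y ∈ Icc (0 : ℝ) 1, |ψ (s, y)| ≤ N) →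
      (∀ s, ∀ p y, 0 ≤ p → p ≤ y → y ≤ 1 → |ψ (s, y) - ψ (s, p)| ≤ L * (y - p)) →
      (∀ s s', ∀ p ∈ Icc (0 : ℝ) 1, |∫ r in s..s', ψ (r, p)| ≤ W) →
      ∀ t, ∀ x ∈ Icc (0 : ℝ) 1,
        |∫ y in (0 : ℝ)..x, κ (t, y) * σ' y * ψ (t + σ y, y)| ≤ ε * (N + L) + C * W := by
  obtain ⟨K, hK0, hK⟩ := hκ.bounded
  obtain ⟨S₀, hS₀⟩ := (isCompact_Icc (a := (0 : ℝ)) (b := 1)).exists_bound_of_continuousOn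
    hσ'.continuousOn
  set S := max S₀ 1
  have hS0 : 0 < S := by positivity
  have hS : ∀ y ∈ Icc (0 : ℝ) 1, |σ' y| ≤ S := fun y hy => (hS₀ y hy).trans (le_max_left _ _)
  obtain ⟨δ, hδ, hκδ⟩ := hκ.unif (ε := ε / S) (by positivity)
  -- With `n` pieces, `1 / n < δ` keeps the oscillation of `κ` below `ε / S`, which pays for `N`,
  -- and `S * K / n < ε` pays for `L`. Each piece costs `K * W`, hence the constant `n * K`.
  obtain ⟨n, hn⟩ := exists_nat_gt (max (1 / δ) (S * K / ε))
  have hn1 : 1 / δ < n := (le_max_left _ _).trans_lt hn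
  have hn2 : S * K / ε < n := (le_max_right _ _).trans_lt hn
  have hn0 : (0 : ℝ) < n := lt_trans (by positivity) hn1
  refine ⟨n * K, by positivity, fun ψ N L W hψ hN0 hL0 hW0 hN hL hW t x hx => ?_⟩
  have hx0 := hx.1
  set P : ℕ → ℝ := fun i => i * (x / n) with hP
  have hPsucc : ∀ i, P (i + 1) - P i = x / n := fun i => by simp only [hP]; push_cast; ring
  have hstep0 : 0 ≤ x / n := by positivity
  have hPle : ∀ i, i ≤ n → P i ≤ x := fun i hi => by
    have : (i : ℝ) ≤ n := by exact_mod_cast hi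
    calc P i ≤ n * (x / n) := by simp only [hP]; gcongr
      _ = x := by field_simp
  have hP0 : ∀ i, 0 ≤ P i := fun i => by simp only [hP]; positivity
  have hxn : x / n ≤ 1 / n := by gcongr; exact hx.2
  have h1n : 1 / (n : ℝ) < δ := by
    rw [div_lt_iff₀ hn0]; rw [div_lt_iff₀ hδ] at hn1; linarith
  have hcσ : Continuous σ := continuous_iff_continuousAt.2 fun x => (hσ x).continuousAt
  have hc := hκ.cont
  have hcont : Continuous fun y => κ (t, y) * σ' y * ψ (t + σ y, y) := by fun_prop
  have hsum := intervalIntegral.sum_integral_adjacent_intervals (μ := volume) (n := n) (a := P)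
    (f := fun y => κ (t, y) * σ' y * ψ (t + σ y, y))
    (fun i _ => hcont.intervalIntegrable _ _)
  have hPn : P n = x := by simp only [hP]; field_simp
  have hPz : P 0 = 0 := by simp [hP]
  rw [hPn, hPz] at hsum
  rw [← hsum]
  refine (Finset.abs_sum_le_sum_abs _ _).trans ?_
  have hpiece : ∀ i ∈ Finset.range n,
      |∫ y in P i..P (i + 1), κ (t, y) * σ' y * ψ (t + σ y, y)| ≤
        S * (K * (L * (1 / n)) + ε / S * N) * (1 / n) + K * W := by
    intro i hi
    have hi' : i + 1 ≤ n := Finset.mem_range.1 hi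
    have hle : P i ≤ P (i + 1) := by linarith [hPsucc i]
    have hmem : ∀ y ∈ Icc (P i) (P (i + 1)), y ∈ Icc (0 : ℝ) 1 := fun y hy =>
      ⟨(hP0 i).trans hy.1, hy.2.trans ((hPle _ hi').trans hx.2)⟩
    have hdist : ∀ y ∈ Icc (P i) (P (i + 1)), y - P i ≤ 1 / n := fun y hy => by
      linarith [hy.2, hPsucc i]
    have := abs_integral_piece_le (κ := fun y => κ (t, y)) (σ := fun y => t + σ y) (σ' := σ')
      (ψ := ψ) (by fun_prop) hσ' (fun y => (hσ y).const_add t) hψ hle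
      (S := S) (K := K) (N := N) (W := W) (η := ε / S) (ℓ := L * (1 / n))
      (fun y hy => hS y (hmem y hy)) (fun y hy => hK t y (hmem y hy))
      (fun y hy => (hκδ t t y (hmem y hy) (P i) (hmem _ (left_mem_Icc.2 hle)) (by simpa using hδ)
        (by rw [abs_of_nonneg (by linarith [hy.1])]; linarith [hdist y hy])).le)
      (fun s => hN s _ (hmem _ (left_mem_Icc.2 hle)))
      (fun s y hy => (hL s _ y (hP0 i) hy.1 (hmem y hy).2).trans
        (mul_le_mul_of_nonneg_left (hdist y hy) hL0))
      (fun s s' => hW s s' _ (hmem _ (left_mem_Icc.2 hle)))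
    refine this.trans ?_
    rw [hPsucc]
    gcongr
  refine (Finset.sum_le_sum hpiece).trans ?_
  rw [Finset.sum_const, Finset.card_range, nsmul_eq_mul]
  have e : (n : ℝ) * (S * (K * (L * (1 / n)) + ε / S * N) * (1 / n) + K * W) =
      S * K / n * L + ε * N + n * K * W := by field_simp
  rw [e]
  have : S * K / n ≤ ε := by
    rw [div_le_iff₀ hn0]; rw [div_lt_iff₀ hε] at hn2; linarith
  nlinarith [mul_le_mul_of_nonneg_right this hL0]

/-! ### Transport along characteristics -/

/-- Variation of constants along characteristics. -/
lemma CharSol.duhamel {ρ : ℝ → ℝ} (hρ : Continuous ρ) {v b h : ℝ × ℝ → ℝ} (hv : Continuous v)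
    (hb : Continuous b) (hh : Continuous h) (H : CharSol ρ v (fun p => b p * v p + h p))
    (t : ℝ) {x : ℝ} (hx : x ∈ Icc (0 : ℝ) 1) :
    Real.exp (-prim (fun y => ρ y * b (t + prim ρ y, y)) x) * v (t + prim ρ x, x) =
      v (t, 0) + ∫ y in (0 : ℝ)..x, Real.exp (-prim (fun y => ρ y * b (t + prim ρ y, y)) y) *
        (ρ y * h (t + prim ρ y, y)) := by
  set B := prim (fun y => ρ y * b (t + prim ρ y, y)) with hB
  have hβ := continuous_along_mul hρ hb t
  have hη := continuous_along_mul hρ hh t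
  have hBc : Continuous B := continuous_prim hβ
  have hBd : ∀ y, HasDerivAt B (ρ y * b (t + prim ρ y, y)) y := fun y => hasDerivAt_prim hβ y
  have hrhs : Continuous fun y => ρ y * (b (t + prim ρ y, y) * v (t + prim ρ y, y)
      + h (t + prim ρ y, y)) := continuous_along_mul (h := fun p => b p * v p + h p) hρ
        (by fun_prop) t
  have hPd : ∀ y, HasDerivAt (fun y => v (t, 0) + prim (fun y => ρ y * (b (t + prim ρ y, y) *
      v (t + prim ρ y, y) + h (t + prim ρ y, y))) y) _ y :=
    fun y => (hasDerivAt_prim hrhs y).const_add _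
  -- `φ` is differentiable on all of `ℝ` and agrees with `v` along the characteristic over `[0, 1]`,
  -- so no one-sided derivatives of `v` are needed.
  set φ := fun y => v (t, 0) + prim (fun y => ρ y * (b (t + prim ρ y, y) *
      v (t + prim ρ y, y) + h (t + prim ρ y, y))) y with hφ
  have hφv : ∀ y ∈ Icc (0 : ℝ) 1, φ y = v (t + prim ρ y, y) := fun y hy => (H t y hy).symm
  have hder : ∀ y ∈ uIcc 0 x, HasDerivAt (fun y => Real.exp (-B y) * φ y)
      (Real.exp (-B y) * (ρ y * h (t + prim ρ y, y))) y := by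
    intro y hy
    rw [uIcc_of_le hx.1] at hy
    have := ((hBd y).neg.exp).mul (hPd y)
    refine this.congr_deriv ?_
    change Real.exp (-B y) * -(ρ y * b (t + prim ρ y, y)) * φ y + _ = _
    rw [hφv y ⟨hy.1, hy.2.trans hx.2⟩]
    simp only [Pi.neg_apply]
    ring
  have := intervalIntegral.integral_eq_sub_of_hasDerivAt hder
    (Continuous.intervalIntegrable (by fun_prop) _ _)
  rw [this, ← hφv x hx]
  simp [hφ, hB, prim_zero]

/-- The integral of `ρ b` along the characteristic through `(t, 0)`, from `0` to `x`. -/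
def charInt (ρ : ℝ → ℝ) (b : ℝ × ℝ → ℝ) (p : ℝ × ℝ) : ℝ :=
  prim (fun y => ρ y * b (p.1 + prim ρ y, y)) p.2

lemma ContPer.charInt {ρ : ℝ → ℝ} (hρ : Continuous ρ) {b : ℝ × ℝ → ℝ} (hb : ContPer b) :
    ContPer (charInt ρ b) := by
  have := continuous_prim hρ
  have hc := hb.cont
  refine ⟨?_, fun t x => ?_⟩
  · have : Continuous (Function.uncurry fun (p : ℝ × ℝ) y => ρ y * b (p.1 + prim ρ y, y)) := by
      simp only [Function.uncurry_def]
      fun_prop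
    exact intervalIntegral.continuous_parametric_intervalIntegral_of_continuous this continuous_snd
  · simp only [HypSys.charInt, add_right_comm t 1, hb.per]

lemma ContPer.comp {F : ℝ × ℝ → ℝ} (hF : ContPer F) {g : ℝ → ℝ} (hg : Continuous g) :
    ContPer (fun p => g (F p)) :=
  ⟨hg.comp hF.cont, fun t x => by rw [hF.per]⟩

lemma ContPer.of_space {g : ℝ → ℝ} (hg : Continuous g) : ContPer (fun p => g p.2) :=
  ⟨hg.comp continuous_snd, fun _ _ => rfl⟩

/-- A continuous solution is Lipschitz along its own characteristics, whatever its regularity in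
other directions. This supplies the constant `L` of `averaging`. -/
lemma CharSol.abs_sub_le {ρ : ℝ → ℝ} (hρ : Continuous ρ) {v h : ℝ × ℝ → ℝ} (H : CharSol ρ v h)
    (hh : Continuous h) {R M : ℝ} (hR : ∀ y ∈ Icc (0 : ℝ) 1, |ρ y| ≤ R) (hM : ∀ p, |h p| ≤ M)
    (t : ℝ) {p y : ℝ} (hp : 0 ≤ p) (hpy : p ≤ y) (hy : y ≤ 1) :
    |v (t + prim ρ y, y) - v (t + prim ρ p, p)| ≤ R * M * (y - p) := by
  have hc := continuous_along_mul hρ hh t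
  rw [H t y ⟨hp.trans hpy, hy⟩, H t p ⟨hp, hpy.trans hy⟩, add_sub_add_left_eq_sub,
    intervalIntegral.integral_interval_sub_left (hc.intervalIntegrable _ _)
      (hc.intervalIntegrable _ _)]
  have := intervalIntegral.norm_integral_le_of_norm_le_const (a := p) (b := y)
      (f := fun y => ρ y * h (t + prim ρ y, y)) (C := R * M) (fun z hz => by
        rw [uIoc_of_le hpy] at hz
        rw [Real.norm_eq_abs, abs_mul]
        have := hR z ⟨hp.trans hz.1.le, hz.2.trans hy⟩
        exact mul_le_mul this (hM _) (abs_nonneg _) ((abs_nonneg _).trans this))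
  rwa [abs_of_nonneg (sub_nonneg.2 hpy), Real.norm_eq_abs] at this

lemma exists_abs_le_Icc {ρ : ℝ → ℝ} (hρ : Continuous ρ) :
    ∃ R > 0, ∀ y ∈ Icc (0 : ℝ) 1, |ρ y| ≤ R := by
  obtain ⟨R, hR⟩ := (isCompact_Icc (a := (0 : ℝ)) (b := 1)).exists_bound_of_continuousOn
    hρ.continuousOn
  exact ⟨max R 1, by positivity, fun y hy => (hR y hy).trans (le_max_left _ _)⟩

/-- Up to a small multiple of the sup norm and the weak norm, the solution of the first equation is
transported along its characteristics, with the growth given by the diagonal coefficient. -/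
lemma transport_estimate {ρ ρ' : ℝ → ℝ} (hρ : Continuous ρ) (hρ' : Continuous ρ')
    (hne : ∀ y, ρ y ≠ ρ' y) {b c b' c' : ℝ × ℝ → ℝ} (hb : Per b) (hc : Per c) (hb' : Per b')
    (hc' : Per c') {ε : ℝ} (hε : 0 < ε) :
    ∃ C > 0, ∀ (v w g g' : ℝ × ℝ → ℝ) (N G W : ℝ), Per v → Per w → Per g → Per g' →
      0 ≤ N → 0 ≤ G → 0 ≤ W → (∀ p, |v p| ≤ N) → (∀ p, |w p| ≤ N) → (∀ p, |g p| ≤ G) →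
      (∀ p, |g' p| ≤ G) → (∀ s s', ∀ x ∈ Icc (0 : ℝ) 1, |∫ r in s..s', w (r, x)| ≤ W) →
      CharSol ρ v (fun p => b p * v p + (c p * w p + g p)) →
      CharSol ρ' w (fun p => b' p * w p + (c' p * v p + g' p)) →
      ∀ t, ∀ x ∈ Icc (0 : ℝ) 1,
        |Real.exp (-charInt ρ b (t, x)) * v (t + prim ρ x, x) - v (t, 0)| ≤
          ε * N + C * (G + W) := by
  obtain ⟨R, hR0, hR⟩ := exists_abs_le_Icc hρ
  obtain ⟨R', hR'0, hR'⟩ := exists_abs_le_Icc hρ'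
  obtain ⟨K₁, hK₁0, hK₁⟩ := hb'.bounded
  obtain ⟨K₂, hK₂0, hK₂⟩ := hc'.bounded
  have hBc : ContPer (fun p => Real.exp (-charInt ρ b p)) :=
    (ContPer.charInt hρ hb.toContPer).comp (g := fun s => Real.exp (-s)) (by fun_prop)
  obtain ⟨E, hE0, hE⟩ := hBc.bounded
  -- Division by `ρ - ρ'`, possible because the speeds differ, creates the factor `σ'` required by
  -- `averaging`.
  set κ : ℝ × ℝ → ℝ := fun p => Real.exp (-charInt ρ b p) *
    ((ρ p.2 / (ρ p.2 - ρ' p.2)) * along ρ c p) with hκdef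
  have hκ : ContPer κ := hBc.mul ((ContPer.of_space (g := fun y => ρ y / (ρ y - ρ' y))
    (hρ.div (hρ.sub hρ') fun y => sub_ne_zero.2 (hne y))).mul (hc.toContPer.along hρ))
  -- The Lipschitz constant below is `R' * ((K₁ + K₂) * N + G)`, so `N + L = M * N + R' * G`, and
  -- the choice `ε / M` yields exactly `ε * N`.
  set M := 1 + R' * (K₁ + K₂) with hM
  have hM0 : 0 < M := by positivity
  -- `t + σ y` is the time at which the `ρ'`-characteristic through the point at height `y` of the
  -- `ρ`-characteristic from `(t, 0)` passes `x = 0`.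
  obtain ⟨C, hC0, hC⟩ := averaging hκ (σ := fun y => prim ρ y - prim ρ' y)
    (σ' := fun y => ρ y - ρ' y) (hρ.sub hρ')
    (fun y => (hasDerivAt_prim hρ y).sub (hasDerivAt_prim hρ' y)) (ε := ε / M) (by positivity)
  refine ⟨ε / M * R' + C + E * R, by positivity, ?_⟩
  intro v w g g' N G W hv hw hg hg' hN0 hG0 hW0 hvN hwN hgG hg'G hwW Hv Hw t x hx
  have hbc := hb.cont
  have hcc := hc.cont
  have hgc := hg.cont
  have hwc := hw.cont
  have hvc := hv.cont
  have hpρ := continuous_prim hρ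
  have hpρ' := continuous_prim hρ'
  have hd := CharSol.duhamel hρ hv.cont hb.cont (h := fun p => c p * w p + g p) (by fun_prop) Hv
    t hx
  change Real.exp (-charInt ρ b (t, x)) * _ = _ + ∫ y in (0 : ℝ)..x,
    Real.exp (-charInt ρ b (t, y)) * _ at hd
  have hec := (ContPer.charInt hρ hb.toContPer).cont
  have hκc := hκ.cont
  have hgr : Per (fun p => b' p * w p + (c' p * v p + g' p)) :=
    (hb'.mul hw).add ((hc'.mul hv).add hg')
  have havg := hC (along ρ' w) N (R' * ((K₁ + K₂) * N + G)) W (continuous_along hρ' hw.cont) hN0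
    (by positivity) hW0 (fun s y _ => hwN _)
    (fun s p y hp hpy hy => Hw.abs_sub_le hρ' hgr.cont hR' (fun q => by
      have h1 := mul_le_mul (hK₁ q) (hwN q) (abs_nonneg _) hK₁0.le
      have h2 := mul_le_mul (hK₂ q) (hvN q) (abs_nonneg _) hK₂0.le
      rw [← abs_mul] at h1 h2
      have h3 := abs_add_le (b' q * w q) (c' q * v q + g' q)
      have h4 := abs_add_le (c' q * v q) (g' q)
      linarith [hg'G q]) s hp hpy hy)
    (fun s s' p hp => by
      simp only [along]
      rw [intervalIntegral.integral_comp_add_right (fun r => w (r, p))]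
      exact hwW _ _ _ hp) t x hx
  have hsplit : ∫ y in (0 : ℝ)..x, Real.exp (-charInt ρ b (t, y)) *
        (ρ y * (c (t + prim ρ y, y) * w (t + prim ρ y, y) + g (t + prim ρ y, y))) =
      (∫ y in (0 : ℝ)..x, κ (t, y) * (ρ y - ρ' y) *
        along ρ' w (t + (prim ρ y - prim ρ' y), y)) +
      ∫ y in (0 : ℝ)..x, Real.exp (-charInt ρ b (t, y)) * (ρ y * g (t + prim ρ y, y)) := by
    rw [← intervalIntegral.integral_add]
    · refine intervalIntegral.integral_congr fun y _ => ?_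
      have hy : ρ y - ρ' y ≠ 0 := sub_ne_zero.2 (hne y)
      have e : t + (prim ρ y - prim ρ' y) + prim ρ' y = t + prim ρ y := by ring
      simp only [hκdef, along, e]
      field_simp
    · have := continuous_along hρ' hw.cont
      exact Continuous.intervalIntegrable (by fun_prop) _ _
    · exact Continuous.intervalIntegrable (by fun_prop) _ _
  have hrest := intervalIntegral.norm_integral_le_of_norm_le_const (a := (0 : ℝ)) (b := x)
      (f := fun y => Real.exp (-charInt ρ b (t, y)) * (ρ y * g (t + prim ρ y, y)))
      (C := E * (R * G)) (fun z hz => by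
        rw [uIoc_of_le hx.1] at hz
        have hz' : z ∈ Icc (0 : ℝ) 1 := ⟨hz.1.le, hz.2.trans hx.2⟩
        rw [Real.norm_eq_abs, abs_mul, abs_mul]
        exact mul_le_mul (hE t z hz') (mul_le_mul (hR z hz') (hgG _) (abs_nonneg _) hR0.le)
          (by positivity) hE0.le)
  rw [sub_zero, abs_of_nonneg hx.1, Real.norm_eq_abs] at hrest
  have hrest' : E * (R * G) * x ≤ E * (R * G) := mul_le_of_le_one_right (by positivity) hx.2
  rw [hd, add_sub_cancel_left, hsplit]
  refine (abs_add_le _ _).trans ((add_le_add havg (hrest.trans hrest')).trans ?_)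
  have e : ε / M * (N + R' * ((K₁ + K₂) * N + G)) = ε * N + ε / M * R' * G := by
    field_simp
    rw [hM]; ring
  rw [e]
  have : 0 ≤ (ε / M * R' + E * R) * W + C * G := by positivity
  nlinarith

/-! ### Boundary reflections and the role of non-resonance -/

/-- A finite least bound is what permits absorption: an estimate that improves every bound applies
to the least one. -/
lemma exists_least_bound {ι : Type*} [Nonempty ι] {F : ι → ℝ} (h : ∃ K, ∀ i, |F i| ≤ K) :
    ∃ N, (∀ i, |F i| ≤ N) ∧ ∀ K, (∀ i, |F i| ≤ K) → N ≤ K := by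
  obtain ⟨K, hK⟩ := h
  exact ⟨⨆ i, |F i|, le_ciSup (f := fun i => |F i|) ⟨K, by rintro _ ⟨i, rfl⟩; exact hK i⟩,
    fun K hK => ciSup_le hK⟩

lemma exists_bound_pair {v : Fin 2 → ℝ × ℝ → ℝ} (hv : ∀ j, Per (v j)) :
    ∃ K > 0, ∀ j p, |v j p| ≤ K := by
  choose N hN0 hN using fun j => (hv j).bounded
  refine ⟨max (N 0) (N 1), lt_max_of_lt_left (hN0 0), fun j p => (hN j p).trans ?_⟩
  fin_cases j
  exacts [le_max_left _ _, le_max_right _ _]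

lemma exists_least_bound_pair {v : Fin 2 → ℝ × ℝ → ℝ} (hv : ∀ j, Per (v j)) :
    ∃ N, 0 ≤ N ∧ (∀ j p, |v j p| ≤ N) ∧ ∀ K, (∀ j p, |v j p| ≤ K) → N ≤ K := by
  obtain ⟨K, -, hK⟩ := exists_bound_pair hv
  obtain ⟨N, h1, h2⟩ := exists_least_bound (F := fun q : Fin 2 × ℝ × ℝ => v q.1 q.2)
    ⟨K, fun q => hK q.1 q.2⟩
  exact ⟨N, (abs_nonneg _).trans (h1 (0, 0)), fun j p => h1 (j, p),
    fun K hK => h2 K fun q => hK q.1 q.2⟩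

/-- A bounded solution of `w(t + p) = c(t) w(t + q) + O(d)` is `O(d)` if `c` is periodic,
continuous and never `±1`. -/
lemma abs_le_of_transport {c : ℝ → ℝ} (hc : Continuous c) (hper : ∀ t, c (t + 1) = c t)
    (hne : ∀ t, |c t| ≠ 1) :
    ∃ C > 0, ∀ (w : ℝ → ℝ) (p q d : ℝ), 0 ≤ d → (∃ N, ∀ t, |w t| ≤ N) →
      (∀ t, |w (t + p) - c t * w (t + q)| ≤ d) → ∀ t, |w t| ≤ C * d := by
  have hP : ContPer (fun z => |c z.1|) := ⟨by fun_prop, fun t x => by simp only [hper]⟩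
  have hcpt : IsCompact (Icc (0 : ℝ) 1) := isCompact_Icc
  have hcn : (Icc (0 : ℝ) 1).Nonempty := ⟨0, by simp⟩
  have hred : ∀ t, ∃ s ∈ Icc (0 : ℝ) 1, c t = c s := fun t => by
    refine ⟨t - ⌊t⌋, ⟨by linarith [Int.floor_le t], by linarith [Int.lt_floor_add_one t]⟩, ?_⟩
    have h : Function.Periodic c 1 := hper
    simpa using (h.sub_int_mul_eq (x := t) ⌊t⌋).symm
  have hcont : Continuous fun t => |c t| := hc.abs
  obtain ⟨m, hm, hmmin⟩ := hcpt.exists_isMinOn hcn hcont.continuousOn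
  obtain ⟨M, hM, hMmax⟩ := hcpt.exists_isMaxOn hcn hcont.continuousOn
  have hmin : ∀ t, |c m| ≤ |c t| := fun t => by
    obtain ⟨s, hs, e⟩ := hred t; rw [e]; exact hmmin hs
  have hmax : ∀ t, |c t| ≤ |c M| := fun t => by
    obtain ⟨s, hs, e⟩ := hred t; rw [e]; exact hMmax hs
  rcases lt_or_gt_of_ne (hne M) with h | h
  -- Here `|c| ≤ |c M| < 1`, and the relation is a contraction read forwards: `N ≤ |c M| * N + d`.
  · refine ⟨1 / (1 - |c M|), by have := sub_pos.2 h; positivity, fun w p q d hd hw hwd t => ?_⟩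
    obtain ⟨N, hN, hNle⟩ := exists_least_bound hw
    have : N ≤ |c M| * N + d := hNle _ fun t => by
      have h1 := hwd (t - p)
      rw [sub_add_cancel] at h1
      have h2 := abs_sub_abs_le_abs_sub (w t) (c (t - p) * w (t - p + q))
      have h3 : |c (t - p) * w (t - p + q)| ≤ |c M| * N := by
        rw [abs_mul]; exact mul_le_mul (hmax _) (hN _) (abs_nonneg _) (abs_nonneg _)
      linarith
    refine (hN t).trans ?_
    rw [div_mul_eq_mul_div, one_mul, le_div_iff₀ (sub_pos.2 h)]
    linarith
  -- A value of `|c|` above `1` forces the minimum above `1`, since `|c|` would otherwise take the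
  -- value `1`. The relation is then solved for the other term, giving `N ≤ (N + d) / |c m|`.
  · have hm1 : 1 < |c m| := by
      by_contra hcon
      obtain ⟨t, -, ht⟩ := intermediate_value_uIcc (a := m) (b := M) hcont.continuousOn
        (show (1 : ℝ) ∈ uIcc |c m| |c M| from by
          rw [uIcc_of_le ((not_lt.1 hcon).trans h.le)]; exact ⟨not_lt.1 hcon, h.le⟩)
      exact hne t ht
    refine ⟨1 / (|c m| - 1), by have := sub_pos.2 hm1; positivity, fun w p q d hd hw hwd t => ?_⟩
    obtain ⟨N, hN, hNle⟩ := exists_least_bound hw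
    have hc0 : 0 < |c m| := by linarith
    have : N ≤ (N + d) / |c m| := hNle _ fun t => by
      have h1 := hwd (t - q)
      rw [sub_add_cancel] at h1
      have h2 := abs_sub_abs_le_abs_sub (c (t - q) * w t) (w (t - q + p))
      rw [abs_sub_comm] at h2
      rw [le_div_iff₀ hc0]
      have h3 : |w t| * |c m| ≤ |c (t - q) * w t| := by
        rw [abs_mul, mul_comm]
        exact mul_le_mul_of_nonneg_right (hmin _) (abs_nonneg _)
      linarith [hN (t - q + p)]
    rw [le_div_iff₀ hc0] at this
    refine (hN t).trans ?_
    rw [div_mul_eq_mul_div, one_mul, le_div_iff₀ (sub_pos.2 hm1)]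
    linarith

/-- Solutions of the linear boundary value problem
`∂_t v_j + a_j ∂_x v_j = ∑_k b_{jk} v_k + g_j`, integrated along the characteristics. -/
structure LinSol (ρ : Fin 2 → ℝ → ℝ) (r₁ r₂ : ℝ) (b : Fin 2 → Fin 2 → ℝ × ℝ → ℝ)
    (v g : Fin 2 → ℝ × ℝ → ℝ) : Prop where
  per_sol : ∀ j, Per (v j)
  per_rhs : ∀ j, Per (g j)
  boundary : BoundaryCond r₁ r₂ v
  char : ∀ j, CharSol (ρ j) (v j) (fun p => ∑ k, b j k p * v k p + g j p)

/-- The non-resonance condition for the linear problem, on characteristics that meet at `x = 1` or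
on characteristics that meet at `x = 0`. -/
def LinNonResonant (ρ : Fin 2 → ℝ → ℝ) (r₁ r₂ : ℝ) (b : Fin 2 → Fin 2 → ℝ × ℝ → ℝ) : Prop :=
  NonResonant r₁ r₂ (fun t => charInt (ρ 0) (b 0 0) (t - prim (ρ 0) 1, 1) -
      charInt (ρ 1) (b 1 1) (t - prim (ρ 1) 1, 1)) ∨
    NonResonant r₁ r₂ (fun t => charInt (ρ 0) (b 0 0) (t, 1) - charInt (ρ 1) (b 1 1) (t, 1))

/-- Taking logarithms turns modulus `1` into the excluded value of `I`; when `r₁ r₂ = 0` the modulus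
is `0`, in accordance with the convention `ln 0 = -∞`. -/
lemma NonResonant.abs_ne_one {r₁ r₂ : ℝ} {I : ℝ → ℝ} (h : NonResonant r₁ r₂ I) (t : ℝ) :
    |r₁ * r₂ * Real.exp (I t)| ≠ 1 := by
  intro hc
  rw [abs_mul, Real.abs_exp] at hc
  have h0 : r₁ * r₂ ≠ 0 := fun h0 => by simp [h0] at hc
  refine h h0 t ?_
  have := congrArg Real.log hc
  rw [Real.log_mul (abs_ne_zero.2 h0) (Real.exp_ne_zero _), Real.log_exp, Real.log_one] at this
  linarith

/-- If solutions are transported along characteristics up to an error `D` and the boundary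
reflections are not resonant, they are bounded by a multiple of `D`. -/
lemma boundary_estimate {ρ : Fin 2 → ℝ → ℝ} (hρ : ∀ j, Continuous (ρ j)) {r₁ r₂ : ℝ}
    {b : Fin 2 → Fin 2 → ℝ × ℝ → ℝ} (hb : ∀ j k, Per (b j k)) (hres : LinNonResonant ρ r₁ r₂ b) :
    ∃ C > 0, ∀ (v : Fin 2 → ℝ × ℝ → ℝ) (D : ℝ), (∀ j, Per (v j)) → BoundaryCond r₁ r₂ v → 0 ≤ D →
      (∀ j t, ∀ x ∈ Icc (0 : ℝ) 1, |Real.exp (-charInt (ρ j) (b j j) (t, x)) *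
        v j (t + prim (ρ j) x, x) - v j (t, 0)| ≤ D) → ∀ j p, |v j p| ≤ C * D := by
  have hB : ∀ j, ContPer (charInt (ρ j) (b j j)) := fun j =>
    ContPer.charInt (hρ j) (hb j j).toContPer
  have hE : ∀ j, ∃ E > 0, ∀ t, ∀ x ∈ Icc (0 : ℝ) 1,
      Real.exp (-charInt (ρ j) (b j j) (t, x)) ≤ E ∧
        Real.exp (charInt (ρ j) (b j j) (t, x)) ≤ E := by
    intro j
    obtain ⟨K, hK, h⟩ := (hB j).bounded
    exact ⟨Real.exp K, Real.exp_pos _, fun t x hx =>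
      ⟨Real.exp_le_exp.2 (neg_le.1 (abs_le.1 (h t x hx)).1),
      Real.exp_le_exp.2 (abs_le.1 (h t x hx)).2⟩⟩
  choose E' hE'0 hE' using hE
  set E := max (E' 0) (E' 1) with hEdef
  have hE0 : 0 < E := lt_max_of_lt_left (hE'0 0)
  have hEm : ∀ j t, ∀ x ∈ Icc (0 : ℝ) 1, Real.exp (-charInt (ρ j) (b j j) (t, x)) ≤ E := by
    intro j t x hx
    refine (hE' j t x hx).1.trans ?_
    fin_cases j
    exacts [le_max_left _ _, le_max_right _ _]
  have hEp : ∀ j t, ∀ x ∈ Icc (0 : ℝ) 1, Real.exp (charInt (ρ j) (b j j) (t, x)) ≤ E := by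
    intro j t x hx
    refine (hE' j t x hx).2.trans ?_
    fin_cases j
    exacts [le_max_left _ _, le_max_right _ _]
  have h0m : (0 : ℝ) ∈ Icc (0 : ℝ) 1 := left_mem_Icc.2 zero_le_one
  have h1m : (1 : ℝ) ∈ Icc (0 : ℝ) 1 := right_mem_Icc.2 zero_le_one
  have hcancel : ∀ s : ℝ, Real.exp s * Real.exp (-s) = 1 := fun s => by
    rw [← Real.exp_add, add_neg_cancel, Real.exp_zero]
  -- Transport from `x = 0` reduces everything to bounds on the traces at `x = 0`.
  have hinterior : ∀ (v : Fin 2 → ℝ × ℝ → ℝ) (D M : ℝ), (∀ j, Per (v j)) → 0 ≤ D →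
      (∀ j t, ∀ x ∈ Icc (0 : ℝ) 1, |Real.exp (-charInt (ρ j) (b j j) (t, x)) *
        v j (t + prim (ρ j) x, x) - v j (t, 0)| ≤ D) →
      (∀ j t, |v j (t, 0)| ≤ M) → ∀ j p, |v j p| ≤ E * (M + D) := by
    intro v D M hv hD h hM j p
    have hx := clamp_mem p.2
    have h1 := h j (p.1 - prim (ρ j) (clamp p.2)) _ hx
    rw [sub_add_cancel, (hv j).clamp] at h1
    have h2 := hM j (p.1 - prim (ρ j) (clamp p.2))
    set s := charInt (ρ j) (b j j) (p.1 - prim (ρ j) (clamp p.2), clamp p.2)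
    have h3 : |Real.exp (-s) * v j p| ≤ M + D := by
      have := abs_sub_abs_le_abs_sub (Real.exp (-s) * v j p) (v j (p.1 - prim (ρ j) (clamp p.2), 0))
      have h1' : |Real.exp (-s) * v j p - v j (p.1 - prim (ρ j) (clamp p.2), 0)| ≤ D := h1
      linarith
    calc |v j p| = Real.exp s * |Real.exp (-s) * v j p| := by
          rw [abs_mul, Real.abs_exp, ← mul_assoc, hcancel, one_mul]
      _ ≤ E * (M + D) := mul_le_mul (hEp j _ _ hx) h3 (abs_nonneg _) hE0.le
  have hbdd : ∀ {v : Fin 2 → ℝ × ℝ → ℝ}, (∀ j, Per (v j)) → ∀ j y, ∃ N, ∀ t, |v j (t, y)| ≤ N :=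
    fun hv j y => by obtain ⟨N, -, hN⟩ := (hv j).bounded; exact ⟨N, fun t => hN _⟩
  rcases hres with hres | hres
  · obtain ⟨C, hC0, hC⟩ := abs_le_of_transport (c := fun t => r₁ * r₂ * Real.exp
        (charInt (ρ 0) (b 0 0) (t - prim (ρ 0) 1, 1) - charInt (ρ 1) (b 1 1) (t - prim (ρ 1) 1, 1)))
      (by have h0 := (hB 0).cont; have h1 := (hB 1).cont; fun_prop)
      (fun t => by simp only [add_sub_right_comm t 1, (hB _).per]) hres.abs_ne_one
    refine ⟨E * ((1 + |r₁|) * (C * (1 + |r₂| * E * E)) + 1), by positivity, ?_⟩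
    intro v D hv hbc hD h
    -- Both characteristics that meet at `(t, 1)` are followed back to `x = 0`. Eliminating `v 0 (t,
    -- 1)` by the two boundary conditions relates the trace of `v 1` at their two starting times.
    have hw := hC (fun t => v 1 (t, 0)) (-prim (ρ 1) 1) (-prim (ρ 0) 1) (D + |r₂| * E * E * D)
      (by positivity) (hbdd hv 1 0) (fun t => by
        have h1 := h 1 (t - prim (ρ 1) 1) 1 h1m
        have h0 := h 0 (t - prim (ρ 0) 1) 1 h1m
        have e1 := hEm 1 (t - prim (ρ 1) 1) 1 h1m
        have e0 := hEp 0 (t - prim (ρ 0) 1) 1 h1m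
        rw [sub_add_cancel] at h0 h1
        rw [(hbc t).2] at h1
        rw [(hbc _).1] at h0
        have hcc := hcancel (charInt (ρ 0) (b 0 0) (t - prim (ρ 0) 1, 1))
        simp only [← sub_eq_add_neg]
        rw [sub_eq_add_neg (charInt _ _ _), Real.exp_add]
        have hP0 := Real.exp_pos (charInt (ρ 0) (b 0 0) (t - prim (ρ 0) 1, 1))
        generalize Real.exp (charInt (ρ 0) (b 0 0) (t - prim (ρ 0) 1, 1)) = P at *
        generalize Real.exp (-charInt (ρ 0) (b 0 0) (t - prim (ρ 0) 1, 1)) = P' at *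
        have hQ0 := Real.exp_pos (-charInt (ρ 1) (b 1 1) (t - prim (ρ 1) 1, 1))
        generalize Real.exp (-charInt (ρ 1) (b 1 1) (t - prim (ρ 1) 1, 1)) = Q at *
        have e : v 1 (t - prim (ρ 1) 1, 0) - r₁ * r₂ * (P * Q) * v 1 (t - prim (ρ 0) 1, 0) =
          -(Q * (r₂ * v 0 (t, 1)) - v 1 (t - prim (ρ 1) 1, 0)) +
            r₂ * Q * P * (P' * v 0 (t, 1) - r₁ * v 1 (t - prim (ρ 0) 1, 0)) := by
          linear_combination (-(r₂ * Q * v 0 (t, 1))) * hcc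
        rw [e]
        refine (abs_add_le _ _).trans (add_le_add (by rwa [abs_neg]) ?_)
        rw [abs_mul, abs_mul, abs_mul, abs_of_pos hQ0, abs_of_pos hP0]
        gcongr)
    have hM0 : 0 ≤ C * (D + |r₂| * E * E * D) := by positivity
    refine fun j p => (hinterior v D ((1 + |r₁|) * (C * (D + |r₂| * E * E * D))) hv hD h ?_ j p).trans
      (le_of_eq (by ring))
    intro j t
    have h1 := hw t
    fin_cases j
    · change |v 0 (t, 0)| ≤ _
      rw [(hbc t).1, abs_mul]
      have := mul_le_mul_of_nonneg_left h1 (abs_nonneg r₁)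
      linarith
    · change |v 1 (t, 0)| ≤ _
      have := mul_nonneg (abs_nonneg r₁) hM0
      linarith
  · obtain ⟨C, hC0, hC⟩ := abs_le_of_transport (c := fun t => r₁ * r₂ * Real.exp
        (charInt (ρ 0) (b 0 0) (t, 1) - charInt (ρ 1) (b 1 1) (t, 1)))
      (by have h0 := (hB 0).cont; have h1 := (hB 1).cont; fun_prop)
      (fun t => by simp only [(hB _).per]) hres.abs_ne_one
    refine ⟨E * ((1 + |r₁|) * (1 + E * (|r₂| * (C * (E * (1 + |r₁|))))) + 1), by positivity, ?_⟩
    intro v D hv hbc hD h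
    -- Now both characteristics issue from `(t, 0)`; eliminating `v 1 (t, 0)` relates the trace of
    -- `v 0` on `x = 1` at their two arrival times.
    have hz := hC (fun t => v 0 (t, 1)) (prim (ρ 0) 1) (prim (ρ 1) 1) (E * (D + |r₁| * D))
      (by positivity) (hbdd hv 0 1) (fun t => by
        have h1 := h 1 t 1 h1m
        have h0 := h 0 t 1 h1m
        have e0 := hEp 0 t 1 h1m
        rw [(hbc _).2] at h1
        rw [(hbc _).1] at h0
        have hcc := hcancel (charInt (ρ 0) (b 0 0) (t, 1))
        rw [sub_eq_add_neg (charInt _ _ _), Real.exp_add]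
        have hP0 := Real.exp_pos (charInt (ρ 0) (b 0 0) (t, 1))
        generalize Real.exp (charInt (ρ 0) (b 0 0) (t, 1)) = P at *
        generalize Real.exp (-charInt (ρ 0) (b 0 0) (t, 1)) = P' at *
        generalize Real.exp (-charInt (ρ 1) (b 1 1) (t, 1)) = Q at *
        have e : v 0 (t + prim (ρ 0) 1, 1) - r₁ * r₂ * (P * Q) * v 0 (t + prim (ρ 1) 1, 1) =
          P * ((P' * v 0 (t + prim (ρ 0) 1, 1) - r₁ * v 1 (t, 0)) -
            r₁ * (Q * (r₂ * v 0 (t + prim (ρ 1) 1, 1)) - v 1 (t, 0))) := by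
          linear_combination (-(v 0 (t + prim (ρ 0) 1, 1))) * hcc
        rw [e, abs_mul, abs_of_pos hP0]
        refine mul_le_mul e0 ((abs_sub _ _).trans ?_) (abs_nonneg _) hE0.le
        rw [abs_mul]
        gcongr)
    have hw : ∀ t, |v 1 (t, 0)| ≤ D + E * (|r₂| * (C * (E * (D + |r₁| * D)))) := fun t => by
      have h1 := h 1 t 1 h1m
      rw [(hbc _).2] at h1
      have h2 := abs_sub_abs_le_abs_sub (v 1 (t, 0))
        (Real.exp (-charInt (ρ 1) (b 1 1) (t, 1)) * (r₂ * v 0 (t + prim (ρ 1) 1, 1)))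
      rw [abs_sub_comm, abs_mul, abs_mul, Real.abs_exp] at h2
      have h3 : Real.exp (-charInt (ρ 1) (b 1 1) (t, 1)) * (|r₂| * |v 0 (t + prim (ρ 1) 1, 1)|) ≤
          E * (|r₂| * (C * (E * (D + |r₁| * D)))) := by
        have := hEm 1 t 1 h1m
        have h4 := hz (t + prim (ρ 1) 1)
        gcongr
      linarith
    refine fun j p => (hinterior v D ((1 + |r₁|) * (D + E * (|r₂| * (C * (E * (D + |r₁| * D))))))
      hv hD h ?_ j p).trans (le_of_eq (by ring))
    intro j t
    have h1 := hw t
    have hM0 := (abs_nonneg _).trans h1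
    fin_cases j
    · change |v 0 (t, 0)| ≤ _
      rw [(hbc t).1, abs_mul]
      have := mul_le_mul_of_nonneg_left h1 (abs_nonneg r₁)
      linarith
    · change |v 1 (t, 0)| ≤ _
      have := mul_nonneg (abs_nonneg r₁) hM0
      linarith

/-! ### The a priori estimate -/

/-- A priori estimate: solutions of the non-resonant linear problem are bounded by the right-hand
side and by their primitives with respect to time. -/
theorem LinSol.estimate {ρ : Fin 2 → ℝ → ℝ} (hρ : ∀ j, Continuous (ρ j))
    (hne : ∀ y, ρ 0 y ≠ ρ 1 y) {r₁ r₂ : ℝ} {b : Fin 2 → Fin 2 → ℝ × ℝ → ℝ}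
    (hb : ∀ j k, Per (b j k)) (hres : LinNonResonant ρ r₁ r₂ b) :
    ∃ C > 0, ∀ (v g : Fin 2 → ℝ × ℝ → ℝ) (G W : ℝ), LinSol ρ r₁ r₂ b v g → 0 ≤ G → 0 ≤ W →
      (∀ j p, |g j p| ≤ G) →
      (∀ j s s', ∀ x ∈ Icc (0 : ℝ) 1, |∫ r in s..s', v j (r, x)| ≤ W) →
      ∀ j p, |v j p| ≤ C * (G + W) := by
  obtain ⟨C₁, hC₁0, hC₁⟩ := boundary_estimate hρ hb hres
  -- After multiplication by `C₁`, the strong term of the transport error becomes `N / 2` and can be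
  -- absorbed.
  have hε : 0 < 1 / (2 * C₁) := by positivity
  obtain ⟨K₀, hK₀0, hK₀⟩ := transport_estimate (hρ 0) (hρ 1) hne (hb 0 0) (hb 0 1) (hb 1 1)
    (hb 1 0) hε
  obtain ⟨K₁, hK₁0, hK₁⟩ := transport_estimate (hρ 1) (hρ 0) (fun y => (hne y).symm) (hb 1 1)
    (hb 1 0) (hb 0 0) (hb 0 1) hε
  refine ⟨2 * (C₁ * (K₀ + K₁)), by positivity, fun v g G W H hG hW hg hv => ?_⟩
  have hself : ∀ N, (∀ j p, |v j p| ≤ N) →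
      ∀ j p, |v j p| ≤ N / 2 + C₁ * (K₀ + K₁) * (G + W) := by
    intro N hN
    have hN0 : 0 ≤ N := (abs_nonneg _).trans (hN 0 0)
    have c0 : CharSol (ρ 0) (v 0) (fun p => b 0 0 p * v 0 p + (b 0 1 p * v 1 p + g 0 p)) :=
      (H.char 0).congr (fun _ _ _ => rfl) fun t x _ => by rw [Fin.sum_univ_two, add_assoc]
    have c1 : CharSol (ρ 1) (v 1) (fun p => b 1 1 p * v 1 p + (b 1 0 p * v 0 p + g 1 p)) :=
      (H.char 1).congr (fun _ _ _ => rfl) fun t x _ => by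
        rw [Fin.sum_univ_two, add_comm (b 1 0 _ * _), add_assoc]
    have t0 := hK₀ (v 0) (v 1) (g 0) (g 1) N G W (H.per_sol 0) (H.per_sol 1) (H.per_rhs 0)
      (H.per_rhs 1) hN0 hG hW (hN 0) (hN 1) (hg 0) (hg 1) (hv 1) c0 c1
    have t1 := hK₁ (v 1) (v 0) (g 1) (g 0) N G W (H.per_sol 1) (H.per_sol 0) (H.per_rhs 1)
      (H.per_rhs 0) hN0 hG hW (hN 1) (hN 0) (hg 1) (hg 0) (hv 0) c1 c0
    have hGW : 0 ≤ G + W := add_nonneg hG hW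
    intro j p
    refine (hC₁ v (1 / (2 * C₁) * N + (K₀ + K₁) * (G + W)) H.per_sol H.boundary (by positivity)
      ?_ j p).trans (le_of_eq (by field_simp))
    intro j t x hx
    have m0 := mul_nonneg hK₀0.le hGW
    have m1 := mul_nonneg hK₁0.le hGW
    fin_cases j
    · exact (t0 t x hx).trans (by linarith)
    · exact (t1 t x hx).trans (by linarith)
  obtain ⟨N, -, hN, hNle⟩ := exists_least_bound_pair H.per_sol
  have hle := hNle _ (hself N hN)
  intro j p
  linarith [hN j p]

lemma exists_pos_forall_pair {P : Fin 2 → ℝ → Prop} (h : ∀ j, ∃ δ > 0, ∀ s, |s| < δ → P j s) :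
    ∃ δ > 0, ∀ j s, |s| < δ → P j s := by
  choose δ hδ0 hδ using h
  refine ⟨min (δ 0) (δ 1), lt_min (hδ0 0) (hδ0 1), fun j s hs => hδ j s (hs.trans_le ?_)⟩
  fin_cases j
  exacts [min_le_left _ _, min_le_right _ _]

/-! ### Difference quotients and the first time derivative -/

/-- The difference quotient with respect to time. -/
def dq (h : ℝ) (F : ℝ × ℝ → ℝ) (p : ℝ × ℝ) : ℝ := h⁻¹ * (F (p.1 + h, p.2) - F p)

lemma Per.dq {F : ℝ × ℝ → ℝ} (hF : Per F) (h : ℝ) : Per (dq h F) :=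
  ((hF.shift h).sub hF).const_mul _

lemma Per.of_tendstoUniformly {ι : Type*} {l : Filter ι} [l.NeBot] {F : ι → ℝ × ℝ → ℝ}
    {f : ℝ × ℝ → ℝ} (hF : ∀ i, Per (F i)) (h : TendstoUniformly F f l) : Per f := by
  refine ⟨⟨h.continuous (Frequently.of_forall fun i => (hF i).cont), fun t x => ?_⟩, fun t x => ?_⟩
  · exact tendsto_nhds_unique
      ((h.tendsto_at (t + 1, x)).congr fun i => (hF i).per t x) (h.tendsto_at (t, x))
  · exact tendsto_nhds_unique
      ((h.tendsto_at (t, HypSys.clamp x)).congr fun i => (hF i).clamp t x) (h.tendsto_at (t, x))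

lemma CharSol.dq {ρ : ℝ → ℝ} (hρ : Continuous ρ) {v h : ℝ × ℝ → ℝ} (H : CharSol ρ v h)
    (hh : Continuous h) (s : ℝ) : CharSol ρ (dq s v) (dq s h) :=
  ((H.shift s).linComb hρ H (by fun_prop) hh s⁻¹ (-s⁻¹)).congr
    (fun t x _ => by simp only [HypSys.dq]; ring) (fun t x _ => by simp only [HypSys.dq]; ring)

lemma LinSol.sub {ρ : Fin 2 → ℝ → ℝ} (hρ : ∀ j, Continuous (ρ j)) {r₁ r₂ : ℝ}
    {b : Fin 2 → Fin 2 → ℝ × ℝ → ℝ} (hb : ∀ j k, Per (b j k)) {v g v' g' : Fin 2 → ℝ × ℝ → ℝ}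
    (H : LinSol ρ r₁ r₂ b v g) (H' : LinSol ρ r₁ r₂ b v' g') :
    LinSol ρ r₁ r₂ b (fun j p => v j p - v' j p) (fun j p => g j p - g' j p) := by
  refine ⟨fun j => (H.per_sol j).sub (H'.per_sol j), fun j => (H.per_rhs j).sub (H'.per_rhs j),
    fun t => ⟨?_, ?_⟩, fun j => ?_⟩
  · simp only [(H.boundary t).1, (H'.boundary t).1]; ring
  · simp only [(H.boundary t).2, (H'.boundary t).2]; ring
  · have hc : ∀ {v g}, LinSol ρ r₁ r₂ b v g → Continuous fun p => ∑ k, b j k p * v k p + g j p :=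
      fun H => ((Per.sum Finset.univ fun k _ => (hb j k).mul (H.per_sol k)).add (H.per_rhs j)).cont
    refine ((H.char j).linComb (hρ j) (H'.char j) (hc H) (hc H') 1 (-1)).congr
      (fun t x _ => by ring) (fun t x _ => ?_)
    simp only [Fin.sum_univ_two]
    ring

lemma abs_inv_mul_integral_sub_le {φ : ℝ → ℝ} (hφ : Continuous φ) {η h s : ℝ} (hh : h ≠ 0)
    (H : ∀ r, |r - s| ≤ |h| → |φ r - φ s| ≤ η) : |h⁻¹ * (∫ r in s..s + h, φ r) - φ s| ≤ η := by
  have e : h⁻¹ * (∫ r in s..s + h, φ r) - φ s = h⁻¹ * ∫ r in s..s + h, (φ r - φ s) := by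
    rw [intervalIntegral.integral_sub (hφ.intervalIntegrable _ _) (by simp),
      intervalIntegral.integral_const]
    simp only [add_sub_cancel_left, smul_eq_mul]
    field_simp
  have h1 := intervalIntegral.norm_integral_le_of_norm_le_const (a := s) (b := s + h)
      (f := fun r => φ r - φ s) (C := η) (fun r hr => H r (by
        simpa using abs_sub_left_of_mem_uIcc (uIoc_subset_uIcc hr)))
  rw [e, abs_mul, abs_inv, ← Real.norm_eq_abs (∫ r in s..s + h, _), inv_mul_le_iff₀ (abs_pos.2 hh)]
  rw [add_sub_cancel_left] at h1
  linarith

/-- Overlapping parts of the two integrals cancel, leaving averages near the endpoints. Hence weak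
norms of difference quotients require only continuity of `φ`. -/
lemma integral_diffQuot {φ : ℝ → ℝ} (hφ : Continuous φ) (h s s' : ℝ) :
    ∫ r in s..s', h⁻¹ * (φ (r + h) - φ r) =
      h⁻¹ * (∫ r in s'..s' + h, φ r) - h⁻¹ * ∫ r in s..s + h, φ r := by
  have hi : ∀ a b, IntervalIntegrable φ volume a b := fun a b => hφ.intervalIntegrable a b
  have hi' : IntervalIntegrable (fun r => φ (r + h)) volume s s' :=
    Continuous.intervalIntegrable (by fun_prop) _ _
  rw [intervalIntegral.integral_const_mul, intervalIntegral.integral_sub hi' (hi _ _),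
    intervalIntegral.integral_comp_add_right φ, ← mul_sub,
    intervalIntegral.integral_interval_sub_interval_comm (hi _ _) (hi _ _) (hi _ _),
    intervalIntegral.integral_symm (s' + h) s', intervalIntegral.integral_symm (s + h) s]
  ring

/-- The primitives in time of difference quotients converge uniformly. -/
lemma integral_dq_tendsto {u : Fin 2 → ℝ × ℝ → ℝ} (hu : ∀ j, Per (u j)) {η : ℝ} (hη : 0 < η) :
    ∃ δ > 0, ∀ j h, |h| < δ → h ≠ 0 → ∀ s s' x,
      |(∫ r in s..s', dq h (u j) (r, x)) - (u j (s', x) - u j (s, x))| ≤ η := by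
  refine exists_pos_forall_pair fun j => ?_
  obtain ⟨δ, hδ0, hδ⟩ := (hu j).unif_time (half_pos hη)
  refine ⟨δ, hδ0, fun h hh h0 s s' x => ?_⟩
  have hc : Continuous fun t => u j (t, x) := (hu j).cont.comp (by fun_prop)
  have key : ∀ s, |h⁻¹ * (∫ r in s..s + h, u j (r, x)) - u j (s, x)| ≤ η / 2 := fun s =>
    abs_inv_mul_integral_sub_le hc h0 fun r hr => (hδ r s x (hr.trans_lt hh)).le
  have e := integral_diffQuot hc h s s'
  change ∫ r in s..s', dq h (u j) (r, x) = _ at e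
  rw [e, sub_sub_sub_comm]
  refine (abs_sub _ _).trans ?_
  linarith [key s, key s']

/-- If the right-hand side `H` of a non-resonant problem satisfies the expansion
`H(t + h) - H(t) = ∑_k b_{jk} (u_k(t + h) - u_k(t)) + h m_j + o(|h| + |u(t + h) - u(t)|)` uniformly,
then `u` is continuously differentiable in time and `∂_t u` solves the linearized problem. -/
theorem exists_time_deriv {ρ : Fin 2 → ℝ → ℝ} (hρ : ∀ j, Continuous (ρ j))
    (hne : ∀ y, ρ 0 y ≠ ρ 1 y) {r₁ r₂ : ℝ} {b : Fin 2 → Fin 2 → ℝ × ℝ → ℝ}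
    (hb : ∀ j k, Per (b j k)) (hres : LinNonResonant ρ r₁ r₂ b) {u H m : Fin 2 → ℝ × ℝ → ℝ}
    (hu : ∀ j, Per (u j)) (hH : ∀ j, Per (H j)) (hm : ∀ j, Per (m j)) (hbc : BoundaryCond r₁ r₂ u)
    (hsol : ∀ j, CharSol (ρ j) (u j) (H j))
    (hlin : ∀ ε > 0, ∃ δ > 0, ∀ j h, |h| < δ → ∀ p,
      |H j (p.1 + h, p.2) - H j p - ∑ k, b j k p * (u k (p.1 + h, p.2) - u k p) - h * m j p| ≤
        ε * (|h| + ∑ k, |u k (p.1 + h, p.2) - u k p|)) :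
    ∃ v, LinSol ρ r₁ r₂ b v m ∧ ∀ j t x, HasDerivAt (fun s => u j (s, x)) (v j (t, x)) t := by
  -- The source is defined as whatever makes the difference quotient an exact solution of the linear
  -- problem; `hlin` then says that it is close to `m`.
  set g : ℝ → Fin 2 → ℝ × ℝ → ℝ := fun h j p => dq h (H j) p - ∑ k, b j k p * dq h (u k) p with hg
  have hgs : ∀ h j p, ∑ k, b j k p * dq h (u k) p + g h j p = dq h (H j) p := fun h j p => by
    simp only [hg]; ring
  have hQ : ∀ h, LinSol ρ r₁ r₂ b (fun j => dq h (u j)) (g h) := fun h => by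
    refine ⟨fun j => (hu j).dq h, fun j => ((hH j).dq h).sub
      (Per.sum _ fun k _ => (hb j k).mul ((hu k).dq h)), fun t => ⟨?_, ?_⟩, fun j => ?_⟩
    · simp only [dq, (hbc _).1]; ring
    · simp only [dq, (hbc _).2]; ring
    · exact ((hsol j).dq (hρ j) (hH j).cont h).congr (fun _ _ _ => rfl) fun t x _ =>
        (hgs h j (t, x)).symm
  obtain ⟨C, hC0, hC⟩ := LinSol.estimate hρ hne hb hres
  obtain ⟨U, hU0, hU⟩ := exists_bound_pair hu
  obtain ⟨M, hM0, hM⟩ := exists_bound_pair hm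
  have hgm : ∀ ε > 0, ∃ δ > 0, ∀ h, |h| < δ → h ≠ 0 → ∀ j p,
      |g h j p - m j p| ≤ ε * (1 + ∑ k, |dq h (u k) p|) := fun ε hε => by
    obtain ⟨δ, hδ0, hδ⟩ := hlin ε hε
    refine ⟨δ, hδ0, fun h hh h0 j p => ?_⟩
    have h1 := mul_le_mul_of_nonneg_left (hδ j h hh p) (abs_nonneg h⁻¹)
    rw [← abs_mul] at h1
    have e1 : h⁻¹ * (H j (p.1 + h, p.2) - H j p - ∑ k, b j k p * (u k (p.1 + h, p.2) - u k p) -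
        h * m j p) = g h j p - m j p := by
      simp only [hg, dq, Fin.sum_univ_two]
      field_simp
    have e2 : |h⁻¹| * (ε * (|h| + ∑ k, |u k (p.1 + h, p.2) - u k p|)) =
        ε * (1 + ∑ k, |dq h (u k) p|) := by
      have := abs_ne_zero.2 h0
      simp only [dq, Fin.sum_univ_two, abs_mul, abs_inv]
      field_simp
    rwa [e1, e2] at h1
  have hbound : ∃ N > 0, ∃ δ > 0, ∀ h, |h| < δ → h ≠ 0 → ∀ j p, |dq h (u j) p| ≤ N := by
    -- The source error is relative to the unknown bound `N`; the factor `1 / (4 * C)` turns its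
    -- contribution `C * (1 / (4 * C)) * (2 * N)` into `N / 2`. The weak norm is at most `2 * U +
    -- 1`.
    obtain ⟨δ₁, hδ₁0, hδ₁⟩ := hgm (1 / (4 * C)) (by positivity)
    obtain ⟨δ₂, hδ₂0, hδ₂⟩ := integral_dq_tendsto hu one_pos
    refine ⟨2 * C * (M + 1 / (4 * C) + 2 * U + 1), by positivity, min δ₁ δ₂, by positivity,
      fun h hh h0 => ?_⟩
    obtain ⟨N, hN0, hN, hNle⟩ := exists_least_bound_pair (hQ h).per_sol
    have := hNle _ (hC _ _ (M + 1 / (4 * C) * (1 + 2 * N)) (2 * U + 1) (hQ h) (by positivity)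
      (by positivity) (fun j p => by
        have h1 := hδ₁ h (hh.trans_le (min_le_left _ _)) h0 j p
        rw [Fin.sum_univ_two] at h1
        have h2 : 1 / (4 * C) * (1 + (|dq h (u 0) p| + |dq h (u 1) p|)) ≤
            1 / (4 * C) * (1 + 2 * N) := by
          have := hN 0 p
          have := hN 1 p
          gcongr
          linarith
        have h3 := abs_sub_abs_le_abs_sub (g h j p) (m j p)
        linarith [hM j p])
      (fun j s s' x _ => by
        have h1 := hδ₂ j h (hh.trans_le (min_le_right _ _)) h0 s s' x
        have h2 := abs_sub_abs_le_abs_sub (∫ r in s..s', dq h (u j) (r, x))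
          (u j (s', x) - u j (s, x))
        have h3 := abs_sub (u j (s', x)) (u j (s, x))
        linarith [hU j (s', x), hU j (s, x)]))
    have e : C * (M + 1 / (4 * C) * (1 + 2 * N) + (2 * U + 1)) =
        C * (M + 1 / (4 * C) + 2 * U + 1) + N / 2 := by field_simp; ring
    rw [e] at this
    intro j p
    have h2 : |dq h (u j) p| ≤ N := hN j p
    linarith
  obtain ⟨N, hN0, δ₀, hδ₀0, hN⟩ := hbound
  have hgm' : ∀ ε > 0, ∃ δ > 0, ∀ h, |h| < δ → h ≠ 0 → ∀ j p, |g h j p - m j p| ≤ ε :=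
    fun ε hε => by
      obtain ⟨δ, hδ, h⟩ := hgm (ε / (1 + 2 * N)) (by positivity)
      refine ⟨min δ δ₀, by positivity, fun s hs s0 j p =>
        (h s (hs.trans_le (min_le_left _ _)) s0 j p).trans ?_⟩
      have h1 := hN s (hs.trans_le (min_le_right _ _)) s0
      rw [div_mul_eq_mul_div, div_le_iff₀ (by positivity), Fin.sum_univ_two]
      gcongr
      linarith [h1 0 p, h1 1 p]
  -- The difference of two quotients solves the same linear problem, with source and time primitives
  -- both tending to zero.
  have hcauchy : ∀ ε > 0, ∃ δ > 0, ∀ h h', |h| < δ → h ≠ 0 → |h'| < δ → h' ≠ 0 → ∀ j p,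
      |dq h (u j) p - dq h' (u j) p| ≤ ε := fun ε hε => by
    obtain ⟨δ₁, hδ₁0, hδ₁⟩ := hgm' (ε / (4 * C)) (by positivity)
    obtain ⟨δ₂, hδ₂0, hδ₂⟩ := integral_dq_tendsto hu (η := ε / (4 * C)) (by positivity)
    refine ⟨min δ₁ δ₂, by positivity, fun h h' hh h0 hh' h0' j p => ?_⟩
    have := hC _ _ (ε / (2 * C)) (ε / (2 * C)) ((hQ h).sub hρ hb (hQ h')) (by positivity)
      (by positivity) (fun j p => by
        have h1 := hδ₁ h (hh.trans_le (min_le_left _ _)) h0 j p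
        have h2 := hδ₁ h' (hh'.trans_le (min_le_left _ _)) h0' j p
        rw [abs_sub_comm] at h2
        have h3 := abs_sub_le (g h j p) (m j p) (g h' j p)
        have e : ε / (2 * C) = ε / (4 * C) + ε / (4 * C) := by field_simp; norm_num
        linarith)
      (fun j s s' x _ => by
        have hc : ∀ h, Continuous fun r => dq h (u j) (r, x) := fun h =>
          ((hu j).dq h).cont.comp (by fun_prop)
        have h1 := hδ₂ j h (hh.trans_le (min_le_right _ _)) h0 s s' x
        have h2 := hδ₂ j h' (hh'.trans_le (min_le_right _ _)) h0' s s' x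
        rw [abs_sub_comm] at h2
        have e : ε / (2 * C) = ε / (4 * C) + ε / (4 * C) := by field_simp; norm_num
        rw [intervalIntegral.integral_sub ((hc h).intervalIntegrable _ _)
          ((hc h').intervalIntegrable _ _)]
        have h3 := abs_sub_le (∫ r in s..s', dq h (u j) (r, x)) (u j (s', x) - u j (s, x))
          (∫ r in s..s', dq h' (u j) (r, x))
        linarith) j p
    refine this.trans (le_of_eq ?_)
    field_simp
    norm_num
  have hnhds : ∀ δ > 0, {h : ℝ | |h| < δ ∧ h ≠ 0} ∈ 𝓝[≠] (0 : ℝ) := fun δ hδ => by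
    have : {h : ℝ | |h| < δ} ∈ 𝓝 (0 : ℝ) := by
      filter_upwards [Metric.ball_mem_nhds (0 : ℝ) hδ] with h hh
      simpa using hh
    exact inter_mem (mem_nhdsWithin_of_mem_nhds this) self_mem_nhdsWithin
  have hucs : ∀ j, UniformCauchySeqOn (fun h p => dq h (u j) p) (𝓝[≠] (0 : ℝ)) univ := by
    intro j s hs
    obtain ⟨ε, hε, hεs⟩ := Metric.mem_uniformity_dist.1 hs
    obtain ⟨δ, hδ, h⟩ := hcauchy (ε / 2) (half_pos hε)
    filter_upwards [prod_mem_prod (hnhds δ hδ) (hnhds δ hδ)] with q hq p _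
    refine hεs ?_
    rw [Real.dist_eq]
    exact (h q.1 q.2 hq.1.1 hq.1.2 hq.2.1 hq.2.2 j p).trans_lt (half_lt_self hε)
  have hlim : ∀ j p, ∃ y, Tendsto (fun h => dq h (u j) p) (𝓝[≠] (0 : ℝ)) (𝓝 y) := fun j p =>
    cauchy_map_iff_exists_tendsto.1 ((hucs j).cauchy_map (mem_univ p))
  choose v hv using hlim
  have huni : ∀ j, TendstoUniformlyOn (fun h p => dq h (u j) p) (v j) (𝓝[≠] (0 : ℝ)) univ :=
    fun j => (hucs j).tendstoUniformlyOn_of_tendsto fun p _ => hv j p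
  have hvper : ∀ j, Per (v j) := fun j =>
    Per.of_tendstoUniformly (fun h => (hu j).dq h) (tendstoUniformlyOn_univ.1 (huni j))
  refine ⟨v, ⟨hvper, hm, fun t => ⟨?_, ?_⟩, fun j => ?_⟩, fun j t x => ?_⟩
  · exact tendsto_nhds_unique (hv 0 (t, 0)) (((hv 1 (t, 0)).const_mul r₁).congr fun h =>
      ((hQ h).boundary t).1.symm)
  · exact tendsto_nhds_unique (hv 1 (t, 1)) (((hv 0 (t, 1)).const_mul r₂).congr fun h =>
      ((hQ h).boundary t).2.symm)
  · obtain ⟨B, hB0, hB⟩ := exists_bound_pair (hb j)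
    refine CharSol.of_tendsto (l := 𝓝[≠] (0 : ℝ)) (hρ j) (V := fun h => dq h (u j))
      (H := fun h p => ∑ k, b j k p * dq h (u k) p + g h j p)
      (Eventually.of_forall fun h => Continuous.continuousOn ?_) ?_
      (Eventually.of_forall fun h => (hQ h).char j) (fun t x _ => hv j (t, x)) ?_
    · exact ((Per.sum _ fun k _ => (hb j k).mul ((hu k).dq h)).add ((hQ h).per_rhs j)).cont
    · exact ((Per.sum _ fun k _ => (hb j k).mul (hvper k)).add (hm j)).cont
    · rw [Metric.tendstoUniformlyOn_iff]
      intro ε hε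
      obtain ⟨δ, hδ, hd⟩ := hgm' (ε / 4) (by positivity)
      have hε' : 0 < ε / (4 * B) := by positivity
      filter_upwards [hnhds δ hδ, Metric.tendstoUniformlyOn_iff.1 (huni 0) _ hε',
        Metric.tendstoUniformlyOn_iff.1 (huni 1) _ hε'] with h hh h0 h1 p _
      have h0 := (h0 p (mem_univ _)).le
      have h1 := (h1 p (mem_univ _)).le
      have h2 := hd h hh.1 hh.2 j p
      rw [Real.dist_eq] at h0 h1 ⊢
      rw [abs_sub_comm] at h2
      simp only [Fin.sum_univ_two]
      have e : b j 0 p * v 0 p + b j 1 p * v 1 p + m j p - (b j 0 p * dq h (u 0) p +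
          b j 1 p * dq h (u 1) p + g h j p) = b j 0 p * (v 0 p - dq h (u 0) p) +
          b j 1 p * (v 1 p - dq h (u 1) p) + (m j p - g h j p) := by ring
      rw [e]
      have e4 : B * (ε / (4 * B)) = ε / 4 := by field_simp
      have k0 := mul_le_mul (hB 0 p) h0 (abs_nonneg _) hB0.le
      have k1 := mul_le_mul (hB 1 p) h1 (abs_nonneg _) hB0.le
      rw [← abs_mul, e4] at k0 k1
      have k2 := abs_add_le (b j 0 p * (v 0 p - dq h (u 0) p) + b j 1 p * (v 1 p - dq h (u 1) p))
        (m j p - g h j p)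
      have k3 := abs_add_le (b j 0 p * (v 0 p - dq h (u 0) p)) (b j 1 p * (v 1 p - dq h (u 1) p))
      linarith
  · rw [hasDerivAt_iff_tendsto_slope_zero]
    exact hv j (t, x)

/-! ### Higher time regularity of the linear problem -/

/-- `v` and its first `k` derivatives with respect to time exist and satisfy `Per`. -/
def TimeReg : ℕ → (ℝ × ℝ → ℝ) → Prop
  | 0, v => Per v
  | k + 1, v => Per v ∧ (∀ t x, DifferentiableAt ℝ (fun s => v (s, x)) t) ∧ TimeReg k (dt v)

lemma TimeReg.per {k : ℕ} {v : ℝ × ℝ → ℝ} (h : TimeReg k v) : Per v := by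
  cases k with
  | zero => exact h
  | succ k => exact h.1

lemma TimeReg.hasDerivAt {k : ℕ} {v : ℝ × ℝ → ℝ} (h : TimeReg (k + 1) v) (t x : ℝ) :
    HasDerivAt (fun s => v (s, x)) (dt v (t, x)) t :=
  (h.2.1 t x).hasDerivAt

lemma TimeReg.of_hasDerivAt {k : ℕ} {v v' : ℝ × ℝ → ℝ} (hv : Per v)
    (h : ∀ t x, HasDerivAt (fun s => v (s, x)) (v' (t, x)) t) (hv' : TimeReg k v') :
    TimeReg (k + 1) v := by
  have : dt v = v' := funext fun p => (h p.1 p.2).deriv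
  exact ⟨hv, fun t x => (h t x).differentiableAt, this ▸ hv'⟩

lemma TimeReg.pred {k : ℕ} {v : ℝ × ℝ → ℝ} (h : TimeReg (k + 1) v) : TimeReg k v := by
  induction k generalizing v with
  | zero => exact h.per
  | succ k ih => exact ⟨h.1, h.2.1, ih h.2.2⟩

lemma TimeReg.const (k : ℕ) (c : ℝ) : TimeReg k (fun _ => c) := by
  induction k generalizing c with
  | zero => exact Per.const c
  | succ k ih => exact .of_hasDerivAt (Per.const c) (fun t x => hasDerivAt_const t c) (ih 0)

lemma TimeReg.add {k : ℕ} {v w : ℝ × ℝ → ℝ} (hv : TimeReg k v) (hw : TimeReg k w) :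
    TimeReg k (fun p => v p + w p) := by
  induction k generalizing v w with
  | zero => exact Per.add hv hw
  | succ k ih =>
    exact .of_hasDerivAt (hv.per.add hw.per)
      (fun t x => (hv.hasDerivAt t x).add (hw.hasDerivAt t x)) (ih hv.2.2 hw.2.2)

lemma TimeReg.mul {k : ℕ} {v w : ℝ × ℝ → ℝ} (hv : TimeReg k v) (hw : TimeReg k w) :
    TimeReg k (fun p => v p * w p) := by
  induction k generalizing v w with
  | zero => exact Per.mul hv hw
  | succ k ih =>
    exact .of_hasDerivAt (hv.per.mul hw.per)
      (fun t x => (hv.hasDerivAt t x).mul (hw.hasDerivAt t x))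
      ((ih hv.2.2 hw.pred).add (ih hv.pred hw.2.2))

/-- The mean value inequality for `φ s - s * c`. -/
lemma abs_sub_sub_le_of_hasDerivAt {φ φ' : ℝ → ℝ} (hφ : ∀ s, HasDerivAt φ (φ' s) s)
    {t h c ε : ℝ} (H : ∀ s, |s - t| ≤ |h| → |φ' s - c| ≤ ε) :
    |φ (t + h) - φ t - h * c| ≤ ε * |h| := by
  have := Convex.norm_image_sub_le_of_norm_hasDerivWithin_le (𝕜 := ℝ)
    (f := fun s => φ s - s * c) (f' := fun s => φ' s - 1 * c) (s := uIcc t (t + h)) (C := ε)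
    (x := t) (y := t + h)
    (fun s _ => ((hφ s).sub ((hasDerivAt_id s).mul_const c)).hasDerivWithinAt)
    (fun s hs => by
      rw [one_mul]
      exact H s (by simpa using abs_sub_left_of_mem_uIcc hs))
    (convex_uIcc _ _) left_mem_uIcc right_mem_uIcc
  rw [Real.norm_eq_abs, Real.norm_eq_abs] at this
  convert this using 2 <;> ring_nf

lemma TimeReg.unif_expand {v : ℝ × ℝ → ℝ} (hv : TimeReg 1 v) {ε : ℝ} (hε : 0 < ε) :
    ∃ δ > 0, ∀ h, |h| < δ → ∀ p : ℝ × ℝ,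
      |v (p.1 + h, p.2) - v p - h * dt v p| ≤ ε * |h| := by
  obtain ⟨δ, hδ, H⟩ := Per.unif_time (F := dt v) hv.2.2 hε
  exact ⟨δ, hδ, fun h hh p => abs_sub_sub_le_of_hasDerivAt (φ := fun s => v (s, p.2))
    (fun s => hv.hasDerivAt s p.2) fun s hs => (H s p.1 p.2 (hs.trans_lt hh)).le⟩

/-- The increment of the product exceeds `b Δv` by `(Δb) v + Δb Δv`, and `Δb` is small. No
differentiability of `v` is needed, which is essential because that is what remains to be proved. -/
lemma TimeReg.unif_mul_expand {b v : ℝ × ℝ → ℝ} (hb : TimeReg 1 b) (hv : Per v) {ε : ℝ}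
    (hε : 0 < ε) :
    ∃ δ > 0, ∀ h, |h| < δ → ∀ p : ℝ × ℝ,
      |b (p.1 + h, p.2) * v (p.1 + h, p.2) - b p * v p - b p * (v (p.1 + h, p.2) - v p) -
        h * (dt b p * v p)| ≤ ε * (|h| + |v (p.1 + h, p.2) - v p|) := by
  obtain ⟨V, hV0, hV⟩ := hv.bounded
  obtain ⟨δ₁, hδ₁, H₁⟩ := hb.unif_expand (ε := ε / V) (by positivity)
  obtain ⟨δ₂, hδ₂, H₂⟩ := hb.per.unif_time hε
  refine ⟨min δ₁ δ₂, by positivity, fun h hh p => ?_⟩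
  have h1 := H₁ h (hh.trans_le (min_le_left _ _)) p
  have h2 := (H₂ (p.1 + h) p.1 p.2 (by simpa using hh.trans_le (min_le_right _ _))).le
  have e : b (p.1 + h, p.2) * v (p.1 + h, p.2) - b p * v p - b p * (v (p.1 + h, p.2) - v p) -
        h * (dt b p * v p) = (b (p.1 + h, p.2) - b p - h * dt b p) * v p +
        (b (p.1 + h, p.2) - b p) * (v (p.1 + h, p.2) - v p) := by ring
  rw [e, mul_add]
  refine (abs_add_le _ _).trans (add_le_add ?_ ?_)
  · rw [abs_mul]
    refine (mul_le_mul h1 (hV p) (abs_nonneg _) (by positivity)).trans (le_of_eq ?_)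
    field_simp
  · rw [abs_mul]
    exact mul_le_mul_of_nonneg_right h2 (abs_nonneg _)

/-- Time regularity for the non-resonant linear problem. -/
theorem LinSol.timeReg {ρ : Fin 2 → ℝ → ℝ} (hρ : ∀ j, Continuous (ρ j))
    (hne : ∀ y, ρ 0 y ≠ ρ 1 y) {r₁ r₂ : ℝ} {b : Fin 2 → Fin 2 → ℝ × ℝ → ℝ}
    (hres : LinNonResonant ρ r₁ r₂ b) {n : ℕ} (hb : ∀ j k, TimeReg n (b j k))
    {v g : Fin 2 → ℝ × ℝ → ℝ} (hg : ∀ j, TimeReg n (g j)) (H : LinSol ρ r₁ r₂ b v g) :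
    ∀ j, TimeReg n (v j) := by
  induction n generalizing v g with
  | zero => exact H.per_sol
  | succ n ih =>
    have hv := ih (fun j k => (hb j k).pred) (fun j => (hg j).pred) H
    set m : Fin 2 → ℝ × ℝ → ℝ := fun j p =>
      dt (b j 0) p * v 0 p + dt (b j 1) p * v 1 p + dt (g j) p with hm
    have hmr : ∀ j, TimeReg n (m j) := fun j =>
      (((hb j 0).2.2.mul (hv 0)).add ((hb j 1).2.2.mul (hv 1))).add (hg j).2.2
    have hb' : ∀ j k, TimeReg 1 (b j k) := fun j k =>
      ⟨(hb j k).1, (hb j k).2.1, (hb j k).2.2.per⟩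
    have hg' : ∀ j, TimeReg 1 (g j) := fun j => ⟨(hg j).1, (hg j).2.1, (hg j).2.2.per⟩
    obtain ⟨v', hv', hd⟩ := exists_time_deriv hρ hne (fun j k => (hb j k).per) hres H.per_sol
      (fun j => (Per.sum Finset.univ fun k _ => (hb j k).per.mul (H.per_sol k)).add (H.per_rhs j))
      (fun j => (hmr j).per) H.boundary H.char (fun ε hε => by
        have hε3 : 0 < ε / 2 := by positivity
        refine exists_pos_forall_pair fun j => ?_
        obtain ⟨δ, hδ, h1⟩ := exists_pos_forall_pair fun k =>
          (hb' j k).unif_mul_expand (H.per_sol k) (half_pos hε3)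
        obtain ⟨δ', hδ', h2⟩ := (hg' j).unif_expand hε3
        refine ⟨min δ δ', by positivity, fun h hh p => ?_⟩
        have k0 := h1 0 h (hh.trans_le (min_le_left _ _)) p
        have k1 := h1 1 h (hh.trans_le (min_le_left _ _)) p
        have k2 := h2 h (hh.trans_le (min_le_right _ _)) p
        simp only [Fin.sum_univ_two, hm]
        have := (abs_add_le _ _).trans (add_le_add ((abs_add_le _ _).trans (add_le_add k0 k1)) k2)
        refine (le_of_eq (congrArg abs ?_)).trans (this.trans ?_)
        · ring
        · have := abs_nonneg (v 0 (p.1 + h, p.2) - v 0 p)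
          have := abs_nonneg (v 1 (p.1 + h, p.2) - v 1 p)
          nlinarith)
    -- The derivative solves a problem with the same `b`, hence the same non-resonance condition;
    -- only the source has changed, and the induction is over all sources.
    exact fun j => .of_hasDerivAt (H.per_sol j) (hd j)
      (ih (fun j k => (hb j k).pred) hmr hv' j)

/-! ### Composition with the nonlinearity -/

/-- A family of functions of `(x, u₁, u₂)` that contains all partial derivatives with respect to
`u₁` and `u₂` of its members. -/
structure PartialFamily (F : ℕ → ℕ → ℝ × ℝ × ℝ → ℝ) : Prop where
  cont : ∀ k l, Continuous (F k l)
  clamp : ∀ k l x w, F k l (clamp x, w) = F k l (x, w)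
  deriv₁ : ∀ k l x v₁ v₂, HasDerivAt (fun s => F k l (x, s, v₂)) (F (k + 1) l (x, v₁, v₂)) v₁
  deriv₂ : ∀ k l x v₁ v₂, HasDerivAt (fun s => F k l (x, v₁, s)) (F k (l + 1) (x, v₁, v₂)) v₂

/-- Locally uniform first-order expansion. -/
lemma PartialFamily.unif_expand {F : ℕ → ℕ → ℝ × ℝ × ℝ → ℝ} (hF : PartialFamily F) (k l : ℕ)
    (R : ℝ) {ε : ℝ} (hε : 0 < ε) :
    ∃ δ > 0, ∀ x v₁ v₂ q₁ q₂, |v₁| ≤ R → |v₂| ≤ R → |q₁| < δ → |q₂| < δ →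
      |F k l (x, v₁ + q₁, v₂ + q₂) - F k l (x, v₁, v₂) - (q₁ * F (k + 1) l (x, v₁, v₂) +
        q₂ * F k (l + 1) (x, v₁, v₂))| ≤ ε * (|q₁| + |q₂|) := by
  -- The margin `1` in `R + 1` leaves room for the increments, which are kept below `1`.
  have hcpt := (isCompact_Icc (a := (0 : ℝ)) (b := 1)).prod
    ((isCompact_Icc (a := -(R + 1)) (b := R + 1)).prod (isCompact_Icc (a := -(R + 1)) (b := R + 1)))
  have hunif : ∀ k l, ∃ δ > 0, ∀ x v₁ v₂ w₁ w₂, |v₁| ≤ R + 1 → |v₂| ≤ R + 1 → |w₁| ≤ R + 1 →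
      |w₂| ≤ R + 1 → |w₁ - v₁| < δ → |w₂ - v₂| < δ →
      |F k l (x, w₁, w₂) - F k l (x, v₁, v₂)| ≤ ε := by
    intro k l
    obtain ⟨δ, hδ, h⟩ := Metric.uniformContinuousOn_iff.1
      (hcpt.uniformContinuousOn_of_continuous (hF.cont k l).continuousOn) ε hε
    refine ⟨δ, hδ, fun x v₁ v₂ w₁ w₂ h1 h2 h3 h4 h5 h6 => ?_⟩
    rw [← hF.clamp k l x, ← hF.clamp k l x]
    have := h (HypSys.clamp x, w₁, w₂) ⟨clamp_mem x, abs_le.1 h3, abs_le.1 h4⟩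
      (HypSys.clamp x, v₁, v₂) ⟨clamp_mem x, abs_le.1 h1, abs_le.1 h2⟩ (by
        simp only [Prod.dist_eq, dist_self, Real.dist_eq]
        exact max_lt hδ (max_lt h5 h6))
    exact this.le
  obtain ⟨δ₁, hδ₁, h₁⟩ := hunif (k + 1) l
  obtain ⟨δ₂, hδ₂, h₂⟩ := hunif k (l + 1)
  refine ⟨min 1 (min δ₁ δ₂), by positivity, fun x v₁ v₂ q₁ q₂ hv₁ hv₂ hq₁ hq₂ => ?_⟩
  simp only [lt_min_iff] at hq₁ hq₂
  have bd : ∀ {v s q : ℝ}, |v| ≤ R → |q| < 1 → |s - v| ≤ |q| → |s| ≤ R + 1 := fun hv hq hs => by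
    rw [abs_le] at *
    rw [abs_lt] at hq
    have := abs_lt.2 hq
    constructor <;> linarith
  have bv : ∀ {v : ℝ}, |v| ≤ R → |v| ≤ R + 1 := fun h => by linarith
  -- The increment is split into two coordinate steps: `u₁` moves at height `v₂ + q₂`, then `u₂`
  -- moves at `v₁`.
  have e1 := abs_sub_sub_le_of_hasDerivAt (φ := fun s => F k l (x, s, v₂ + q₂))
    (t := v₁) (h := q₁) (c := F (k + 1) l (x, v₁, v₂)) (ε := ε)
    (fun s => hF.deriv₁ k l x s (v₂ + q₂)) (fun s hs => h₁ x v₁ v₂ s (v₂ + q₂) (bv hv₁) (bv hv₂)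
      (bd hv₁ hq₁.1 hs) (bd hv₂ hq₂.1 (by simp)) (hs.trans_lt hq₁.2.1) (by simpa using hq₂.2.1))
  have e2 := abs_sub_sub_le_of_hasDerivAt (φ := fun s => F k l (x, v₁, s))
    (t := v₂) (h := q₂) (c := F k (l + 1) (x, v₁, v₂)) (ε := ε)
    (fun s => hF.deriv₂ k l x v₁ s) (fun s hs => h₂ x v₁ v₂ v₁ s (bv hv₁) (bv hv₂)
      (bv hv₁) (bd hv₂ hq₂.1 hs) (by simpa using hδ₂) (hs.trans_lt hq₂.2.2))
  have := (abs_add_le _ _).trans (add_le_add e1 e2)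
  refine (le_of_eq (congrArg abs ?_)).trans (this.trans (le_of_eq ?_)) <;> ring

lemma PartialFamily.hasFDerivAt {F : ℕ → ℕ → ℝ × ℝ × ℝ → ℝ} (hF : PartialFamily F) (k l : ℕ)
    (x : ℝ) (v : ℝ × ℝ) : HasFDerivAt (fun w : ℝ × ℝ => F k l (x, w))
      (F (k + 1) l (x, v) • ContinuousLinearMap.fst ℝ ℝ ℝ +
        F k (l + 1) (x, v) • ContinuousLinearMap.snd ℝ ℝ ℝ) v := by
  rw [hasFDerivAt_iff_isLittleO_nhds_zero, Asymptotics.isLittleO_iff]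
  intro c hc
  obtain ⟨δ, hδ, h⟩ := hF.unif_expand k l (max |v.1| |v.2|) (half_pos hc)
  filter_upwards [Metric.ball_mem_nhds (0 : ℝ × ℝ) hδ] with q hq
  rw [mem_ball_zero_iff, Prod.norm_def, max_lt_iff] at hq
  have := h x v.1 v.2 q.1 q.2 (le_max_left _ _) (le_max_right _ _) hq.1 hq.2
  have e1 : |q.1| ≤ ‖q‖ := norm_fst_le q
  have e2 : |q.2| ≤ ‖q‖ := norm_snd_le q
  calc _ = _ := ?_
    _ ≤ _ := this
    _ ≤ c * ‖q‖ := by nlinarith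
  rw [Real.norm_eq_abs]
  simp [mul_comm]
  rfl

/-- Compositions with time-regular functions are time-regular. -/
lemma PartialFamily.timeReg {F : ℕ → ℕ → ℝ × ℝ × ℝ → ℝ} (hF : PartialFamily F) {n : ℕ}
    {u : Fin 2 → ℝ × ℝ → ℝ} (hu : ∀ j, TimeReg n (u j)) (k l : ℕ) :
    TimeReg n (fun p => F k l (jet u p)) := by
  have hper : ∀ k l, Per (fun p => F k l (jet u p)) := fun k l => by
    have h0 := (hu 0).per
    have h1 := (hu 1).per
    have c0 := h0.cont
    have c1 := h1.cont
    have := hF.cont k l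
    refine ⟨⟨by unfold jet; fun_prop, fun t x => ?_⟩, fun t x => ?_⟩
    · simp only [jet, h0.per, h1.per]
    · simp only [jet, h0.clamp, h1.clamp, hF.clamp]
  induction n generalizing k l with
  | zero => exact hper k l
  | succ n ih =>
    have ih' := ih (fun j => (hu j).pred)
    refine .of_hasDerivAt (hper k l) (fun t x => ?_)
      (((ih' (k + 1) l).mul (hu 0).2.2).add ((ih' k (l + 1)).mul (hu 1).2.2))
    have hd := ((hu 0).hasDerivAt t x).prodMk ((hu 1).hasDerivAt t x)
    have := (hF.hasFDerivAt k l x (u 0 (t, x), u 1 (t, x))).comp_hasDerivAt t hd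
    refine this.congr_deriv ?_
    simp [jet]

/-- Time regularity for the nonlinear problem. -/
theorem timeReg_of_charSol {ρ : Fin 2 → ℝ → ℝ} (hρ : ∀ j, Continuous (ρ j))
    (hne : ∀ y, ρ 0 y ≠ ρ 1 y) {r₁ r₂ : ℝ} {F : Fin 2 → ℕ → ℕ → ℝ × ℝ × ℝ → ℝ}
    (hF : ∀ j, PartialFamily (F j)) {u : Fin 2 → ℝ × ℝ → ℝ} (hu : ∀ j, Per (u j))
    (hbc : BoundaryCond r₁ r₂ u)
    (hres : LinNonResonant ρ r₁ r₂
      (fun j => ![fun p => F j 1 0 (jet u p), fun p => F j 0 1 (jet u p)]))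
    (hsol : ∀ j, CharSol (ρ j) (u j) (fun p => F j 0 0 (jet u p))) (n : ℕ) :
    ∀ j, TimeReg n (u j) := by
  set b : Fin 2 → Fin 2 → ℝ × ℝ → ℝ :=
    fun j => ![fun p => F j 1 0 (jet u p), fun p => F j 0 1 (jet u p)] with hbdef
  have hb : ∀ {n}, (∀ j, TimeReg n (u j)) → ∀ j k, TimeReg n (b j k) := fun hu j k => by
    fin_cases k
    exacts [(hF j).timeReg hu 1 0, (hF j).timeReg hu 0 1]
  have hu0 : ∀ j, TimeReg 0 (u j) := hu
  obtain ⟨U, -, hU⟩ := exists_bound_pair hu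
  -- The nonlinearity has no explicit time dependence, so the linearized problem has source `m = 0`.
  obtain ⟨v, hv, hd⟩ := exists_time_deriv hρ hne (m := fun _ _ => 0) (hb hu0) hres hu
    (fun j => (hF j).timeReg hu0 0 0) (fun _ => Per.const 0) hbc hsol (fun ε hε => by
      refine exists_pos_forall_pair fun j => ?_
      obtain ⟨δ, hδ, h1⟩ := (hF j).unif_expand 0 0 U hε
      obtain ⟨δ', hδ', h2⟩ := exists_pos_forall_pair (P := fun j h => ∀ p : ℝ × ℝ,
        |u j (p.1 + h, p.2) - u j p| < δ) fun j => by
          obtain ⟨δ', hδ', h⟩ := (hu j).unif_time hδ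
          exact ⟨δ', hδ', fun s hs p => h _ _ _ (by simpa using hs)⟩
      refine ⟨δ', hδ', fun h hh p => ?_⟩
      have := h1 p.2 (u 0 p) (u 1 p) _ _ (hU 0 p) (hU 1 p) (h2 0 h hh p) (h2 1 h hh p)
      simp only [add_sub_cancel, zero_add] at this
      simp only [Fin.sum_univ_two, hbdef, jet, Matrix.cons_val_zero, Matrix.cons_val_one, mul_zero,
        sub_zero]
      refine (le_of_eq (congrArg abs ?_)).trans (this.trans ?_)
      · ring
      · have := mul_nonneg hε.le (abs_nonneg h)
        linarith)
  -- Regularity `n` of `u` passes to the coefficients, from them to the solution `v = ∂_t u` of the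
  -- linearized problem, and so gives regularity `n + 1` of `u`.
  induction n with
  | zero => exact hu
  | succ n ih =>
    exact fun j => .of_hasDerivAt (hu j) (hd j)
      (hv.timeReg hρ hne hres (hb ih) (fun _ => TimeReg.const n 0) j)

/-! ### Commuting the partial derivatives of the nonlinearity -/

/-- Symmetry of mixed partial derivatives, with existence of the second one as a conclusion. -/
lemma hasDerivAt_mixed {G G₁ G₂ G₂₁ : ℝ → ℝ → ℝ} (h₁ : ∀ x y, HasDerivAt (fun s => G s y) (G₁ x y) x)
    (h₂ : ∀ x y, HasDerivAt (G x) (G₂ x y) y)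
    (h₂₁ : ∀ x y, HasDerivAt (fun s => G₂ s y) (G₂₁ x y) x)
    (c₂ : Continuous fun p : ℝ × ℝ => G₂ p.1 p.2) (c₂₁ : Continuous fun p : ℝ × ℝ => G₂₁ p.1 p.2)
    (x y : ℝ) : HasDerivAt (G₁ x) (G₂₁ x y) y := by
  have hc : ∀ x, Continuous (G₂ x) := fun x => c₂.comp (by fun_prop : Continuous fun y => (x, y))
  have hc' : ∀ x, Continuous (G₂₁ x) := fun x =>
    c₂₁.comp (by fun_prop : Continuous fun y => (x, y))
  have hG : ∀ x z, ∫ r in y..z, G₂ x r = G x z - G x y := fun x z =>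
    intervalIntegral.integral_eq_sub_of_hasDerivAt (fun r _ => h₂ x r)
      ((hc x).intervalIntegrable _ _)
  -- Differentiating `G x z - G x y = ∫ G₂ x` in `x` under the integral sign exhibits `G₁ x` as a
  -- primitive of `G₂₁ x`.
  have key : ∀ z, G₁ x z = G₁ x y + ∫ r in y..z, G₂₁ x r := fun z => by
    obtain ⟨K, hK⟩ := ((isCompact_Icc (a := x - 1) (b := x + 1)).prod
      (isCompact_uIcc (a := y) (b := z))).exists_bound_of_continuousOn c₂₁.continuousOn
    have hd := (intervalIntegral.hasDerivAt_integral_of_dominated_loc_of_deriv_le (μ := volume)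
      (F := G₂) (F' := G₂₁) (x₀ := x) (s := Icc (x - 1) (x + 1)) (a := y) (b := z)
      (bound := fun _ => K) (Icc_mem_nhds (by linarith) (by linarith))
      (Eventually.of_forall fun s => (hc s).aestronglyMeasurable) ((hc x).intervalIntegrable _ _)
      (hc' x).aestronglyMeasurable
      (Eventually.of_forall fun r hr s hs => hK (s, r) ⟨hs, uIoc_subset_uIcc hr⟩)
      intervalIntegrable_const (Eventually.of_forall fun r _ s _ => h₂₁ s r)).2
    simp only [hG] at hd
    rw [hd.unique ((h₁ x z).sub (h₁ x y))]
    ring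
  have := (intervalIntegral.integral_hasDerivAt_right ((hc' x).intervalIntegrable y y)
    (hc' x).aestronglyMeasurable.stronglyMeasurableAtFilter (hc' x).continuousAt).const_add (G₁ x y)
  exact this.congr_of_eventuallyEq (Eventually.of_forall key)

/-- The partial derivatives `∂_{u₁}^k ∂_{u₂}^l g`, extended constantly in `x` outside `[0, 1]`. -/
def duFamily (g : ℝ × ℝ × ℝ → ℝ) (k l : ℕ) (q : ℝ × ℝ × ℝ) : ℝ :=
  (du₁^[k] (du₂^[l] g)) (clamp q.1, q.2)

/-- The hypotheses differentiate in `u₂` first and in `u₁` afterwards. A `u₂`-derivative of a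
function already differentiated in `u₁` comes from `hasDerivAt_mixed`, by induction on the number of
`u₁`-derivatives. -/
lemma SmoothInU.partialFamily {g : ℝ × ℝ × ℝ → ℝ} (hg : SmoothInU g) :
    PartialFamily (duFamily g) := by
  have hcont : ∀ k l, Continuous (duFamily g k l) := fun k l => by
    have hc := continuous_clamp
    exact (hg.continuousOn k l).comp_continuous (f := fun q : ℝ × ℝ × ℝ => (clamp q.1, q.2))
      (by fun_prop) fun q => ⟨clamp_mem q.1, mem_univ _⟩
  have hd₁ : ∀ k l x v₁ v₂, HasDerivAt (fun s => duFamily g k l (x, s, v₂))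
      (duFamily g (k + 1) l (x, v₁, v₂)) v₁ := fun k l x v₁ v₂ => by
    refine (hg.exists_du₁ k l (clamp x) (clamp_mem x) v₁ v₂).hasDerivAt.congr_deriv ?_
    rw [duFamily, Function.iterate_succ_apply']
    rfl
  refine ⟨hcont, fun k l x w => by simp only [duFamily, clamp_clamp], hd₁, fun k => ?_⟩
  induction k with
  | zero =>
    intro l x v₁ v₂
    refine (hg.exists_du₂ l (clamp x) (clamp_mem x) v₁ v₂).hasDerivAt.congr_deriv ?_
    rw [duFamily, Function.iterate_succ_apply' du₂]
    rfl
  | succ k ih =>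
    intro l x v₁ v₂
    have hsec : ∀ {H : ℝ × ℝ × ℝ → ℝ}, Continuous H →
        Continuous fun p : ℝ × ℝ => H (x, p.1, p.2) := fun h => by fun_prop
    exact hasDerivAt_mixed (G := fun s r => duFamily g k l (x, s, r))
      (G₁ := fun s r => duFamily g (k + 1) l (x, s, r))
      (G₂ := fun s r => duFamily g k (l + 1) (x, s, r))
      (G₂₁ := fun s r => duFamily g (k + 1) (l + 1) (x, s, r))
      (fun s r => hd₁ k l x s r) (fun s r => ih l x s r) (fun s r => hd₁ k (l + 1) x s r)
      (hsec (hcont k (l + 1))) (hsec (hcont (k + 1) (l + 1))) v₁ v₂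

lemma TimeReg.iteratedDeriv_eq {v : ℝ × ℝ → ℝ} (k : ℕ) (p : ℝ × ℝ) :
    iteratedDeriv k (fun t => v (t, p.2)) p.1 = (dt^[k] v) p := by
  induction k generalizing p with
  | zero => rfl
  | succ k ih =>
    rw [iteratedDeriv_succ, Function.iterate_succ_apply']
    exact congrArg (fun φ => deriv φ p.1) (funext fun t => ih (t, p.2))

lemma TimeReg.iterate {v : ℝ × ℝ → ℝ} (hv : ∀ n, TimeReg n v) (k n : ℕ) :
    TimeReg n (dt^[k] v) := by
  induction k generalizing v with
  | zero => exact hv n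
  | succ k ih => exact ih fun n => (hv (n + 1)).2.2

lemma TimeReg.smoothInTime {v : ℝ × ℝ → ℝ} (hv : ∀ n, TimeReg n v) : SmoothInTime v := by
  intro k
  refine ⟨fun x _ => ?_, ?_⟩
  · refine contDiff_of_differentiable_iteratedDeriv (n := k) fun m _ t => ?_
    have : iteratedDeriv m (fun t => v (t, x)) = fun t => (dt^[m] v) (t, x) :=
      funext fun t => TimeReg.iteratedDeriv_eq m (t, x)
    rw [this]
    exact (TimeReg.iterate hv m 1).2.1 t x
  · simp only [TimeReg.iteratedDeriv_eq]
    exact (TimeReg.iterate hv k 0).per.cont.continuousOn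

/-! ### From characteristics to derivatives on the strip and back -/

lemma uniqueDiffOn_strip : UniqueDiffOn ℝ strip :=
  uniqueDiffOn_univ.prod (uniqueDiffOn_Icc zero_lt_one)

lemma dt_eq_of_hasFDerivWithinAt {w : ℝ × ℝ → ℝ} {L : ℝ × ℝ →L[ℝ] ℝ} {p : ℝ × ℝ} (hp : p ∈ strip)
    (h : HasFDerivWithinAt w L strip p) : dt w p = L (1, 0) := by
  have hc : HasDerivWithinAt (fun t : ℝ => (t, p.2)) ((1 : ℝ), (0 : ℝ)) univ p.1 :=
    ((hasDerivAt_id p.1).prodMk (hasDerivAt_const p.1 p.2)).hasDerivWithinAt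
  have := h.comp_hasDerivWithinAt (t := strip) p.1 (f := fun t : ℝ => (t, p.2)) hc
    fun t _ => ⟨mem_univ _, hp.2⟩
  exact (hasDerivWithinAt_univ.1 this).deriv

lemma dx_eq_of_hasFDerivWithinAt {w : ℝ × ℝ → ℝ} {L : ℝ × ℝ →L[ℝ] ℝ} {p : ℝ × ℝ} (hp : p ∈ strip)
    (h : HasFDerivWithinAt w L strip p) : dx w p = L (0, 1) := by
  have hc : HasDerivWithinAt (fun x : ℝ => (p.1, x)) ((0 : ℝ), (1 : ℝ)) (Icc 0 1) p.2 :=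
    ((hasDerivAt_const p.2 p.1).prodMk (hasDerivAt_id p.2)).hasDerivWithinAt
  have := h.comp_hasDerivWithinAt (t := strip) p.2 (f := fun x : ℝ => (p.1, x)) hc
    fun x hx => ⟨mem_univ _, hx⟩
  exact this.derivWithin (uniqueDiffOn_Icc zero_lt_one _ hp.2)

lemma contDiffOn_dt {w : ℝ × ℝ → ℝ} {n : ℕ} (hw : ContDiffOn ℝ (n + 1 : ℕ) w strip) :
    ContDiffOn ℝ n (dt w) strip := by
  have h1 : ContDiffOn ℝ n (fderivWithin ℝ w strip) strip :=
    hw.fderivWithin uniqueDiffOn_strip (by norm_cast)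
  refine (h1.clm_apply (contDiffOn_const (c := ((1 : ℝ), (0 : ℝ))))).congr fun p hp => ?_
  exact dt_eq_of_hasFDerivWithinAt hp
    ((hw.differentiableOn (by norm_cast) p hp).hasFDerivWithinAt)

lemma contDiffOn_iterate_dt {w : ℝ × ℝ → ℝ} {n : ℕ} (k : ℕ)
    (hw : ContDiffOn ℝ (n + k : ℕ) w strip) : ContDiffOn ℝ n (dt^[k] w) strip := by
  induction k generalizing w with
  | zero => exact hw
  | succ k ih => exact ih (contDiffOn_dt hw)

lemma continuousOn_dx {w : ℝ × ℝ → ℝ} (hw : ContDiffOn ℝ 1 w strip) :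
    ContinuousOn (dx w) strip := by
  have h1 := hw.continuousOn_fderivWithin uniqueDiffOn_strip le_rfl
  refine (h1.clm_apply (continuousOn_const (c := ((0 : ℝ), (1 : ℝ))))).congr fun p hp => ?_
  exact dx_eq_of_hasFDerivWithinAt hp
    ((hw.differentiableOn one_ne_zero p hp).hasFDerivWithinAt)

lemma continuousOn_transport {w : ℝ × ℝ → ℝ} (hw : ContDiffOn ℝ 1 w strip) {a : ℝ → ℝ}
    (ha : ContinuousOn a (Icc 0 1)) : ContinuousOn (fun p => dt w p + a p.2 * dx w p) strip := by
  have h1 : ContinuousOn (dt w) strip := (contDiffOn_dt (n := 0) (by simpa using hw)).continuousOn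
  exact h1.add ((ha.comp continuousOn_snd fun p hp => hp.2).mul (continuousOn_dx hw))

/-- `C¹` functions, integrated along the characteristics. -/
lemma charSol_of_contDiffOn {ρ : ℝ → ℝ} (hρ : Continuous ρ) {a : ℝ → ℝ}
    (ha : ContinuousOn a (Icc 0 1)) (haρ : ∀ y ∈ Icc (0 : ℝ) 1, ρ y * a y = 1) {w : ℝ × ℝ → ℝ}
    (hw : ContDiffOn ℝ 1 w strip) : CharSol ρ w (fun p => dt w p + a p.2 * dx w p) := by
  intro t x hx
  have hpc := continuous_prim hρ
  have hsub : ∀ {y}, y ∈ Icc 0 x → y ∈ Icc (0 : ℝ) 1 := fun hy => ⟨hy.1, hy.2.trans hx.2⟩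
  have hd : ∀ y ∈ Icc (0 : ℝ) 1, HasDerivWithinAt (fun y => w (t + prim ρ y, y))
      (ρ y * (dt w (t + prim ρ y, y) + a y * dx w (t + prim ρ y, y))) (Icc 0 1) y := by
    intro y hy
    have hp : (t + prim ρ y, y) ∈ strip := ⟨mem_univ _, hy⟩
    have hL := (hw.differentiableOn one_ne_zero _ hp).hasFDerivWithinAt
    have hc : HasDerivWithinAt (fun y : ℝ => (t + prim ρ y, y)) (ρ y, (1 : ℝ)) (Icc 0 1) y :=
      (((hasDerivAt_prim hρ y).const_add t).prodMk (hasDerivAt_id y)).hasDerivWithinAt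
    have := hL.comp_hasDerivWithinAt (t := strip) y (f := fun y : ℝ => (t + prim ρ y, y)) hc
      fun z hz => ⟨mem_univ _, hz⟩
    refine this.congr_deriv ?_
    rw [dt_eq_of_hasFDerivWithinAt hp hL, dx_eq_of_hasFDerivWithinAt hp hL]
    have e : ((ρ y, (1 : ℝ)) : ℝ × ℝ) = ρ y • ((1 : ℝ), (0 : ℝ)) + ((0 : ℝ), (1 : ℝ)) := by simp
    rw [e, map_add, map_smul, smul_eq_mul, mul_add, ← mul_assoc, haρ y hy, one_mul]
  have hcont : ContinuousOn (fun y => ρ y * (dt w (t + prim ρ y, y) +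
      a y * dx w (t + prim ρ y, y))) (uIcc 0 x) := by
    refine hρ.continuousOn.mul ((continuousOn_transport hw ha).comp
      (f := fun y => (t + prim ρ y, y)) (by fun_prop) fun y hy => ⟨mem_univ _, ?_⟩)
    rw [uIcc_of_le hx.1] at hy
    exact hsub hy
  rw [intervalIntegral.integral_eq_sub_of_hasDerivAt_of_le hx.1
    (fun y hy => ((hd y (hsub hy)).continuousWithinAt).mono fun z hz => hsub hz)
    (fun y hy => (hd y (hsub ⟨hy.1.le, hy.2.le⟩)).hasDerivAt
      (Icc_mem_nhds hy.1 (hy.2.trans_le hx.2))) hcont.intervalIntegrable]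
  simp [prim_zero]

/-- Integrated solutions that are `C¹` in time are differentiable on the strip. -/
lemma CharSol.hasFDerivWithinAt {ρ : ℝ → ℝ} (hρ : Continuous ρ) {v h : ℝ × ℝ → ℝ}
    (H : CharSol ρ v h) (hv : TimeReg 1 v) (hh : Continuous h) {p : ℝ × ℝ} (hp : p ∈ strip) :
    HasFDerivWithinAt v (dt v p • ContinuousLinearMap.fst ℝ ℝ ℝ +
      (ρ p.2 * (h p - dt v p)) • ContinuousLinearMap.snd ℝ ℝ ℝ) strip p := by
  obtain ⟨t, x⟩ := p
  set s₀ := t - prim ρ x with hs₀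
  -- `e q` is the time offset of `q` from the characteristic through `(t, x)`. The value `v q` is
  -- the value on that characteristic, differentiable by the equation, plus a time increment, which
  -- is `e q * dt v (t, x)` up to the remainder `S`.
  set e : ℝ × ℝ → ℝ := fun q => q.1 - (s₀ + prim ρ q.2) with he
  set Φ : ℝ → ℝ := fun y => v (s₀, 0) + prim (fun y => ρ y * h (s₀ + prim ρ y, y)) y with hΦ
  have hx0 : s₀ + prim ρ x = t := by simp [hs₀]
  have hΦv : ∀ y ∈ Icc (0 : ℝ) 1, v (s₀ + prim ρ y, y) = Φ y := fun y hy => H s₀ y hy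
  have hΦd : HasDerivAt Φ (ρ x * h (t, x)) x := by
    have := (hasDerivAt_prim (continuous_along_mul hρ hh s₀) x).const_add (v (s₀, 0))
    rwa [hx0] at this
  have hed : HasFDerivAt e (ContinuousLinearMap.fst ℝ ℝ ℝ - ρ x • ContinuousLinearMap.snd ℝ ℝ ℝ)
      (t, x) := by
    have h2 : HasFDerivAt (fun q : ℝ × ℝ => s₀ + prim ρ q.2)
        (ρ x • ContinuousLinearMap.snd ℝ ℝ ℝ) (t, x) :=
      ((hasDerivAt_prim hρ x).const_add s₀).comp_hasFDerivAt (t, x)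
        (f := fun q : ℝ × ℝ => q.2) hasFDerivAt_snd
    exact hasFDerivAt_fst.sub h2
  have he0 : e (t, x) = 0 := by simp [he, hx0]
  set S : ℝ × ℝ → ℝ := fun q => v q - v (s₀ + prim ρ q.2, q.2) - e q * dt v (t, x) with hS
  have hS0 : S (t, x) = 0 := by simp [hS, he0, hx0]
  have hSo : S =o[𝓝 (t, x)] e := by
    rw [Asymptotics.isLittleO_iff]
    intro c hc
    have hcdt : Continuous (dt v) := (show Per (dt v) from hv.2.2).cont
    obtain ⟨δ, hδ, hd⟩ := Metric.continuousAt_iff.1 (hcdt.continuousAt (x := (t, x))) c hc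
    have hc1 : Tendsto (fun q : ℝ × ℝ => |e q| + |s₀ + prim ρ q.2 - t|) (𝓝 (t, x)) (𝓝 0) := by
      have hpc := continuous_prim hρ
      have : Continuous fun q : ℝ × ℝ => |e q| + |s₀ + prim ρ q.2 - t| := by
        simp only [he]; fun_prop
      have := this.tendsto (t, x)
      rwa [he0, hx0, sub_self, abs_zero, add_zero] at this
    have hc2 : Tendsto (fun q : ℝ × ℝ => |q.2 - x|) (𝓝 (t, x)) (𝓝 0) := by
      have : Continuous fun q : ℝ × ℝ => |q.2 - x| := by fun_prop
      simpa using this.tendsto (t, x)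
    filter_upwards [hc1.eventually_lt_const hδ, hc2.eventually_lt_const hδ] with q hq1 hq2
    have := abs_sub_sub_le_of_hasDerivAt (φ := fun s => v (s, q.2))
      (t := s₀ + prim ρ q.2) (h := e q) (c := dt v (t, x)) (ε := c)
      (fun s => hv.hasDerivAt s q.2) (fun s hs => by
        have := hd (x := (s, q.2)) (by
          rw [Prod.dist_eq, Real.dist_eq, Real.dist_eq]
          refine max_lt ?_ hq2
          have := _root_.abs_sub_le s (s₀ + prim ρ q.2) t
          change |s - t| < δ
          linarith)
        rw [Real.dist_eq] at this
        exact this.le)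
    have eq1 : s₀ + prim ρ q.2 + e q = q.1 := by simp [he]
    rw [eq1] at this
    exact this
  have hSd : HasFDerivAt S (0 : ℝ × ℝ →L[ℝ] ℝ) (t, x) := by
    rw [hasFDerivAt_iff_isLittleO]
    have h1 := hed.isBigO_sub
    simp only [he0, sub_zero] at h1
    simpa [hS0] using hSo.trans_isBigO h1
  have hsum := ((hΦd.comp_hasFDerivAt (t, x) (f := fun q : ℝ × ℝ => q.2) hasFDerivAt_snd).add
    (hed.mul_const (dt v (t, x)))).add hSd
  refine (hsum.hasFDerivWithinAt.congr (fun q hq => ?_) ?_).congr_fderiv ?_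
  · have := hΦv q.2 hq.2
    simp only [hS, Pi.add_apply, Function.comp]
    rw [← this]; ring
  · have := hΦv x hp.2
    simp only [hS, Pi.add_apply, Function.comp]
    rw [← this]; ring
  · ext
    · simp
    · simp; ring

lemma contDiffOn_succ_of_partials {v A B : ℝ × ℝ → ℝ} {n : ℕ}
    (h : ∀ p ∈ strip, HasFDerivWithinAt v (A p • ContinuousLinearMap.fst ℝ ℝ ℝ +
      B p • ContinuousLinearMap.snd ℝ ℝ ℝ) strip p)
    (hA : ContDiffOn ℝ n A strip) (hB : ContDiffOn ℝ n B strip) :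
    ContDiffOn ℝ (n + 1 : ℕ) v strip := by
  have := (contDiffOn_succ_iff_hasFDerivWithinAt_of_uniqueDiffOn (n := (n : WithTop ℕ∞)) (f := v)
    uniqueDiffOn_strip).2 ⟨by simp, _, (hA.smul contDiffOn_const).add (hB.smul contDiffOn_const), h⟩
  exact_mod_cast this

/-- Difference quotients solve the integrated equation and their sources converge uniformly, so the
equation passes to the limit. -/
lemma CharSol.dt {ρ : ℝ → ℝ} (hρ : Continuous ρ) {v h : ℝ × ℝ → ℝ} (H : CharSol ρ v h)
    (hv : TimeReg 1 v) (hh : TimeReg 1 h) : CharSol ρ (dt v) (dt h) := by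
  have hhd : Per (HypSys.dt h) := hh.2.2
  refine CharSol.of_tendsto (l := 𝓝[≠] (0 : ℝ)) hρ (V := fun s => HypSys.dq s v)
    (H := fun s => HypSys.dq s h)
    (Eventually.of_forall fun s => (hh.per.dq s).cont.continuousOn) hhd.cont
    (Eventually.of_forall fun s => H.dq hρ hh.per.cont s)
    (fun t x _ => hasDerivAt_iff_tendsto_slope_zero.1 (hv.hasDerivAt t x)) ?_
  rw [Metric.tendstoUniformlyOn_iff]
  intro ε hε
  obtain ⟨δ, hδ, hd⟩ := hh.unif_expand (half_pos hε)
  filter_upwards [mem_nhdsWithin_of_mem_nhds (Metric.ball_mem_nhds (0 : ℝ) hδ),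
    self_mem_nhdsWithin] with s hs hs0 p _
  have h1 := hd s (by simpa using hs) p
  have hs0' : s ≠ 0 := hs0
  rw [dist_comm, Real.dist_eq]
  refine lt_of_le_of_lt ?_ (half_lt_self hε)
  refine le_of_mul_le_mul_right ?_ (abs_pos.2 hs0')
  rw [← abs_mul]
  refine (le_of_eq (congrArg abs ?_)).trans h1
  simp only [HypSys.dq]
  field_simp

/-! ### Application to the given boundary value problem -/

/-- The functions `1 / a_j`, extended constantly outside `[0, 1]`. -/
def invSpeed (a : Fin 2 → ℝ → ℝ) (j : Fin 2) (y : ℝ) : ℝ := 1 / a j (clamp y)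

/-- The extension of a pair of functions on the strip that is constant in `x` outside `[0, 1]`. -/
def extend (u : Fin 2 → ℝ × ℝ → ℝ) (j : Fin 2) (p : ℝ × ℝ) : ℝ := u j (p.1, clamp p.2)

/-- The right-hand side `f_j (x, u)` as a function of `(t, x)`. -/
def source (f : Fin 2 → ℝ × ℝ × ℝ → ℝ) (u : Fin 2 → ℝ × ℝ → ℝ) (j : Fin 2) (p : ℝ × ℝ) : ℝ :=
  duFamily (f j) 0 0 (jet (extend u) p)

section

variable {a : Fin 2 → ℝ → ℝ} {f : Fin 2 → ℝ × ℝ × ℝ → ℝ} {r₁ r₂ : ℝ} {u : Fin 2 → ℝ × ℝ → ℝ}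

lemma extend_eq {j : Fin 2} {p : ℝ × ℝ} (hp : p ∈ strip) : extend u j p = u j p := by
  rw [extend, clamp_of_mem hp.2]

lemma duFamily_jet_extend {g : ℝ × ℝ × ℝ → ℝ} {k l : ℕ} {p : ℝ × ℝ} (hp : p ∈ strip) :
    duFamily g k l (jet (extend u) p) = (du₁^[k] (du₂^[l] g)) (jet u p) := by
  simp only [duFamily, jet, extend_eq hp, clamp_of_mem hp.2]

lemma source_eq {j : Fin 2} {p : ℝ × ℝ} (hp : p ∈ strip) : source f u j p = f j (jet u p) :=
  duFamily_jet_extend hp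

lemma per_extend (hu : ∀ j, ContinuousOn (u j) strip) (hper : TimePeriodic u) (j : Fin 2) :
    Per (extend u j) := by
  have hc := continuous_clamp
  refine ⟨⟨?_, fun t x => hper j t _ (clamp_mem x)⟩, fun t x => by simp only [extend, clamp_clamp]⟩
  exact (hu j).comp_continuous (f := fun p : ℝ × ℝ => (p.1, clamp p.2)) (by fun_prop)
    fun p => ⟨mem_univ _, clamp_mem _⟩

lemma continuous_invSpeed (ha : ∀ j, ContinuousOn (a j) (Icc 0 1))
    (ha_ne : ∀ j, ∀ x ∈ Icc (0 : ℝ) 1, a j x ≠ 0) (j : Fin 2) : Continuous (invSpeed a j) :=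
  continuous_const.div ((ha j).comp_continuous continuous_clamp clamp_mem)
    fun y => ha_ne j _ (clamp_mem y)

lemma prim_invSpeed {j : Fin 2} {x y : ℝ} (hx : x ∈ Icc (0 : ℝ) 1) (hy : y ∈ Icc (0 : ℝ) 1)
    (hc : Continuous (invSpeed a j)) :
    alpha (a j) x y = prim (invSpeed a j) y - prim (invSpeed a j) x := by
  rw [prim, prim, intervalIntegral.integral_interval_sub_left (hc.intervalIntegrable _ _)
    (hc.intervalIntegrable _ _), alpha]
  refine intervalIntegral.integral_congr fun z hz => ?_
  have : z ∈ Icc (0 : ℝ) 1 := ordConnected_Icc.uIcc_subset hx hy hz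
  simp only [invSpeed, clamp_of_mem this]

lemma charInt_sub_charInt {ρ ρ' : ℝ → ℝ} (hρ : Continuous ρ) (hρ' : Continuous ρ')
    {b b' : ℝ × ℝ → ℝ} (hb : Continuous b) (hb' : Continuous b') (t t' : ℝ) :
    charInt ρ b (t, 1) - charInt ρ' b' (t', 1) =
      ∫ y in (0 : ℝ)..1, (ρ y * b (t + prim ρ y, y) - ρ' y * b' (t' + prim ρ' y, y)) :=
  (intervalIntegral.integral_sub ((continuous_along_mul hρ hb t).intervalIntegrable _ _)
    ((continuous_along_mul hρ' hb' t').intervalIntegrable _ _)).symm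

/-- Characteristics are labelled by their time at `x = 0`; those meeting at `(t, 1)` carry the
labels `t - prim (invSpeed a j) 1`, and those meeting at `(t, 0)` the label `t`. With this change of
labels the two formulations agree. -/
lemma linNonResonant (ha : ∀ j, ContinuousOn (a j) (Icc 0 1))
    (ha_ne : ∀ j, ∀ x ∈ Icc (0 : ℝ) 1, a j x ≠ 0) (hf : ∀ j, SmoothInU (f j))
    (hu : ∀ j, Per (extend u j))
    (hres : NonResonant r₁ r₂ (resIntegralOne a f u) ∨
      NonResonant r₁ r₂ (resIntegralZero a f u)) :
    LinNonResonant (invSpeed a) r₁ r₂ (fun j => ![fun p => duFamily (f j) 1 0 (jet (extend u) p),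
      fun p => duFamily (f j) 0 1 (jet (extend u) p)]) := by
  have hρ := continuous_invSpeed ha ha_ne
  have hb : ∀ j k l, Continuous fun p => duFamily (f j) k l (jet (extend u) p) := fun j k l =>
    ((hf j).partialFamily.timeReg (n := 0) hu k l).per.cont
  have h0 : (0 : ℝ) ∈ Icc (0 : ℝ) 1 := left_mem_Icc.2 zero_le_one
  have h1 : (1 : ℝ) ∈ Icc (0 : ℝ) 1 := right_mem_Icc.2 zero_le_one
  refine hres.imp (fun h => ?_) fun h => ?_
  · convert h using 2 with t
    refine (charInt_sub_charInt (hρ 0) (hρ 1) (hb 0 1 0) (hb 1 0 1) _ _).trans ?_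
    refine intervalIntegral.integral_congr fun x hx => ?_
    rw [uIcc_of_le zero_le_one] at hx
    have hs : ∀ s : ℝ, (s, x) ∈ strip := fun s => ⟨mem_univ _, hx⟩
    have e : ∀ j, t - alpha (a j) x 1 =
        t - prim (invSpeed a j) 1 + prim (invSpeed a j) x := fun j => by
      rw [prim_invSpeed hx h1 (hρ j)]; ring
    simp only [e]
    change _ * duFamily (f 0) 1 0 (jet (extend u) (t - prim (invSpeed a 0) 1 +
      prim (invSpeed a 0) x, x)) - _ * duFamily (f 1) 0 1 (jet (extend u)
        (t - prim (invSpeed a 1) 1 + prim (invSpeed a 1) x, x)) = _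
    rw [duFamily_jet_extend (hs _), duFamily_jet_extend (hs _), invSpeed, invSpeed,
      clamp_of_mem hx, one_div_mul_eq_div, one_div_mul_eq_div]
    rfl
  · convert h using 2 with t
    refine (charInt_sub_charInt (hρ 0) (hρ 1) (hb 0 1 0) (hb 1 0 1) _ _).trans ?_
    refine intervalIntegral.integral_congr fun x hx => ?_
    rw [uIcc_of_le zero_le_one] at hx
    have hs : ∀ s : ℝ, (s, x) ∈ strip := fun s => ⟨mem_univ _, hx⟩
    have e : ∀ j, t + alpha (a j) 0 x = t + prim (invSpeed a j) x := fun j => by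
      rw [prim_invSpeed h0 hx (hρ j), prim_zero, sub_zero]
    simp only [e]
    change _ * duFamily (f 0) 1 0 (jet (extend u) (t + prim (invSpeed a 0) x, x)) -
      _ * duFamily (f 1) 0 1 (jet (extend u) (t + prim (invSpeed a 1) x, x)) = _
    rw [duFamily_jet_extend (hs _), duFamily_jet_extend (hs _), invSpeed, invSpeed,
      clamp_of_mem hx, one_div_mul_eq_div, one_div_mul_eq_div]
    rfl

/-- Integration along characteristics sees only the combination `∂_t + a ∂_x`, the one whose
convergence is assumed; the separate partial derivatives need not converge. -/
lemma charSol_of_closure (ha : ∀ j, ContinuousOn (a j) (Icc 0 1))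
    (ha_ne : ∀ j, ∀ x ∈ Icc (0 : ℝ) 1, a j x ≠ 0) (hf : ∀ j, SmoothInU (f j))
    (hu : ∀ j, Per (extend u j)) (hcl : IsClosureSolution a f u) (j : Fin 2) :
    CharSol (invSpeed a j) (extend u j) (source f u j) := by
  obtain ⟨w, hw, hlim⟩ := hcl
  have hρ := continuous_invSpeed ha ha_ne
  have hs := Metric.tendstoUniformlyOn_iff.1 (hlim j)
  refine CharSol.of_tendsto (l := atTop) (hρ j) (V := fun n => w n j)
    (H := fun n p => dt (w n j) p + a j p.2 * dx (w n j) p)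
    (Eventually.of_forall fun n => continuousOn_transport (hw n j) (ha j))
    ((hf j).partialFamily.timeReg (n := 0) hu 0 0).per.cont
    (Eventually.of_forall fun n => charSol_of_contDiffOn (hρ j) (ha j) (fun y hy => ?_) (hw n j))
    (fun t x hx => ?_) ?_
  · rw [invSpeed, clamp_of_mem hy, one_div, inv_mul_cancel₀ (ha_ne j y hy)]
  · rw [Metric.tendsto_nhds]
    intro ε hε
    filter_upwards [hs ε hε] with n hn
    have hp : (t, x) ∈ strip := ⟨mem_univ _, hx⟩
    have := hn _ hp
    rw [dist_comm, Real.dist_eq, sub_zero] at this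
    rw [extend_eq hp, Real.dist_eq]
    have h1 := abs_nonneg (dt (w n j) (t, x) + a j x * dx (w n j) (t, x) - f j (jet u (t, x)))
    have h2 := le_abs_self (|w n j (t, x) - u j (t, x)| +
      |dt (w n j) (t, x) + a j x * dx (w n j) (t, x) - f j (jet u (t, x))|)
    linarith
  · rw [Metric.tendstoUniformlyOn_iff]
    intro ε hε
    filter_upwards [hs ε hε] with n hn p hp
    have := hn _ hp
    rw [dist_comm, Real.dist_eq, sub_zero] at this
    change dist (source f u j p) _ < ε
    rw [source_eq hp, dist_comm, Real.dist_eq]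
    have h1 := abs_nonneg (w n j p - u j p)
    have h2 := le_abs_self (|w n j p - u j p| +
      |dt (w n j) p + a j p.2 * dx (w n j) p - f j (jet u p)|)
    linarith

lemma IsClassicalSolution.isClosureSolution (h : IsClassicalSolution a f r₁ r₂ u) :
    IsClosureSolution a f u := by
  refine ⟨fun _ => u, fun _ => h.contDiffOn, fun j => ?_⟩
  rw [Metric.tendstoUniformlyOn_iff]
  intro ε hε
  refine Eventually.of_forall fun n p hp => ?_
  simpa [h.equation j p hp] using hε

lemma timeReg_extend (ha : ∀ j, ContinuousOn (a j) (Icc 0 1))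
    (ha_ne : ∀ j, ∀ x ∈ Icc (0 : ℝ) 1, a j x ≠ 0)
    (ha_diff : ∀ x ∈ Icc (0 : ℝ) 1, a 0 x ≠ a 1 x) (hf : ∀ j, SmoothInU (f j))
    (hu : ∀ j, Per (extend u j))
    (hres : NonResonant r₁ r₂ (resIntegralOne a f u) ∨
      NonResonant r₁ r₂ (resIntegralZero a f u))
    (hbc : BoundaryCond r₁ r₂ u) (hcl : IsClosureSolution a f u) (n : ℕ) (j : Fin 2) :
    TimeReg n (extend u j) := by
  refine timeReg_of_charSol (continuous_invSpeed ha ha_ne) (fun y => ?_)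
    (fun j => (hf j).partialFamily) hu (r₁ := r₁) (r₂ := r₂) (fun t => ?_)
    (linNonResonant ha ha_ne hf hu hres) (charSol_of_closure ha ha_ne hf hu hcl) n j
  · have := ha_diff _ (clamp_mem y)
    simpa [invSpeed] using this
  · rw [extend_eq ⟨mem_univ _, by simp⟩, extend_eq ⟨mem_univ _, by simp⟩,
      extend_eq ⟨mem_univ _, by simp⟩, extend_eq ⟨mem_univ _, by simp⟩]
    exact hbc t

/-- The `x`-component of the derivative is `(f - ∂_t u) / a`: its continuity gives `C¹`, and its
formula is the differential equation. -/
lemma isClassicalSolution_of_charSol (ha : ∀ j, ContinuousOn (a j) (Icc 0 1))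
    (ha_ne : ∀ j, ∀ x ∈ Icc (0 : ℝ) 1, a j x ≠ 0) (hreg : ∀ j, TimeReg 1 (extend u j))
    (hsrc : ∀ j, Per (source f u j))
    (hsol : ∀ j, CharSol (invSpeed a j) (extend u j) (source f u j))
    (hbc : BoundaryCond r₁ r₂ u) (hper : TimePeriodic u) : IsClassicalSolution a f r₁ r₂ u := by
  have hρ := continuous_invSpeed ha ha_ne
  have hd : ∀ j, ∀ p ∈ strip, HasFDerivWithinAt (u j)
      (dt (extend u j) p • ContinuousLinearMap.fst ℝ ℝ ℝ +
      (invSpeed a j p.2 * (source f u j p - dt (extend u j) p)) •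
        ContinuousLinearMap.snd ℝ ℝ ℝ) strip p := fun j p hp =>
    ((hsol j).hasFDerivWithinAt (hρ j) (hreg j) (hsrc j).cont hp).congr
      (fun q hq => (extend_eq hq).symm) (extend_eq hp).symm
  have hdt : ∀ j, Continuous (dt (extend u j)) := fun j => (hreg j).2.2.per.cont
  refine ⟨fun j => ?_, fun j p hp => ?_, hbc, hper⟩
  · have := contDiffOn_succ_of_partials (n := 0) (hd j)
      (by simpa using (hdt j).continuousOn) (by
        have h1 := hdt j
        have h2 := hρ j
        have h3 := (hsrc j).cont
        simp only [Nat.cast_zero, contDiffOn_zero]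
        exact Continuous.continuousOn (by fun_prop))
    simpa using this
  · rw [dt_eq_of_hasFDerivWithinAt hp (hd j p hp), dx_eq_of_hasFDerivWithinAt hp (hd j p hp),
      ← source_eq (f := f) hp, invSpeed, clamp_of_mem hp.2]
    have := ha_ne j _ hp.2
    simp
    field_simp
    ring

lemma smoothInTime_congr {v w : ℝ × ℝ → ℝ} (h : ∀ p ∈ strip, v p = w p) (hv : SmoothInTime v) :
    SmoothInTime w := by
  have e : ∀ x ∈ Icc (0 : ℝ) 1, (fun t => v (t, x)) = fun t => w (t, x) := fun x hx =>
    funext fun t => h (t, x) ⟨mem_univ _, hx⟩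
  intro k
  refine ⟨fun x hx => e x hx ▸ (hv k).1 x hx, (hv k).2.congr fun p hp => ?_⟩
  simp only [e p.2 hp.2]

/-- All time derivatives are already continuous, and each `x`-derivative is paid for by the equation
`∂_x v = ρ (h - ∂_t v)`. The hypothesis `hcomp` closes the loop: class `Cⁿ` of `v` gives `Cⁿ` of
`h`, which gives `Cⁿ⁺¹` of `v`. -/
lemma contDiffOn_of_charSol {ρ : Fin 2 → ℝ → ℝ} (hρ : ∀ j, Continuous (ρ j))
    (hρs : ∀ j, ContDiffOn ℝ ∞ (ρ j) (Icc 0 1)) {v h : Fin 2 → ℝ × ℝ → ℝ}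
    (hv : ∀ j n, TimeReg n (v j)) (hh : ∀ j n, TimeReg n (h j))
    (hsol : ∀ j, CharSol (ρ j) (v j) (h j))
    (hcomp : ∀ n : ℕ, (∀ j, ContDiffOn ℝ n (v j) strip) → ∀ j, ContDiffOn ℝ n (h j) strip)
    (n : ℕ) (j : Fin 2) : ContDiffOn ℝ n (v j) strip := by
  have hsolk : ∀ j k, CharSol (ρ j) (dt^[k] (v j)) (dt^[k] (h j)) := fun j k => by
    induction k with
    | zero => exact hsol j
    | succ k ih =>
      rw [Function.iterate_succ_apply', Function.iterate_succ_apply']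
      exact ih.dt (hρ j) (TimeReg.iterate (hv j) k 1) (TimeReg.iterate (hh j) k 1)
  induction n generalizing j with
  | zero => simpa using (hv j 0).per.cont.continuousOn
  | succ n ih =>
    have hhn := hcomp n ih
    -- At fixed total order `n + 1`, time derivatives are traded one by one for joint smoothness: `i
    -- = 0` needs only continuity of `∂_t^{n+1} v`, and `k = 0` is the claim.
    have key : ∀ i k, i + k = n + 1 → ContDiffOn ℝ i (dt^[k] (v j)) strip := by
      intro i
      induction i with
      | zero => intro k _; simpa using (TimeReg.iterate (hv j) k 0).per.cont.continuousOn
      | succ i ihi =>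
        intro k hk
        have hA : ContDiffOn ℝ i (dt (dt^[k] (v j))) strip := by
          rw [← Function.iterate_succ_apply' dt]
          exact ihi (k + 1) (by omega)
        have hB : ContDiffOn ℝ i (dt^[k] (h j)) strip :=
          contDiffOn_iterate_dt k (by rw [show i + k = n by omega]; exact hhn j)
        have hR : ContDiffOn ℝ i (fun p : ℝ × ℝ => ρ j p.2) strip :=
          ((hρs j).of_le (by exact_mod_cast le_top)).comp contDiffOn_snd fun p hp => hp.2
        exact contDiffOn_succ_of_partials (fun p hp => (hsolk j k).hasFDerivWithinAt (hρ j)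
          (TimeReg.iterate (hv j) k 1) (TimeReg.iterate (hh j) k 0).per.cont hp) hA
          (hR.mul (hB.sub hA))
    exact key (n + 1) 0 rfl

end

end HypSys

end

theorem theorem1p1
    (a : Fin 2 → ℝ → ℝ) (f : Fin 2 → ℝ × ℝ × ℝ → ℝ) (r₁ r₂ : ℝ)
    (ha : ∀ j, ContinuousOn (a j) (Set.Icc 0 1))
    (ha_ne : ∀ j, ∀ x ∈ Set.Icc (0 : ℝ) 1, a j x ≠ 0)
    (ha_diff : ∀ x ∈ Set.Icc (0 : ℝ) 1, a 0 x ≠ a 1 x)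
    (hf : ∀ j, HypSys.SmoothInU (f j))
    (u : Fin 2 → ℝ × ℝ → ℝ)
    (hu : ∀ j, ContinuousOn (u j) HypSys.strip)
    (hres : HypSys.NonResonant r₁ r₂ (HypSys.resIntegralOne a f u) ∨
      HypSys.NonResonant r₁ r₂ (HypSys.resIntegralZero a f u)) :
    (HypSys.BoundaryCond r₁ r₂ u → HypSys.TimePeriodic u → HypSys.IsClosureSolution a f u →
      HypSys.IsClassicalSolution a f r₁ r₂ u ∧ ∀ j, HypSys.SmoothInTime (u j)) ∧
    (HypSys.IsClassicalSolution a f r₁ r₂ u →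
      (∀ j, ContDiffOn ℝ ∞ (a j) (Set.Icc 0 1)) →
      (∀ j, ContDiffOn ℝ ∞ (f j) HypSys.fdom) →
      ∀ j, ContDiffOn ℝ ∞ (u j) HypSys.strip) := by
  open HypSys in
  have hρ := continuous_invSpeed ha ha_ne
  refine ⟨fun hbc hper hcl => ?_, fun hcs has hfs j => ?_⟩
  · have hext := per_extend hu hper
    have hreg := timeReg_extend ha ha_ne ha_diff hf hext hres hbc hcl
    exact ⟨isClassicalSolution_of_charSol ha ha_ne (hreg 1)
      (fun j => ((hf j).partialFamily.timeReg (hreg 0) 0 0).per)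
      (charSol_of_closure ha ha_ne hf hext hcl) hbc hper,
      fun j => smoothInTime_congr (fun p hp => extend_eq hp)
        (TimeReg.smoothInTime fun n => hreg n j)⟩
  · have hext := per_extend hu hcs.periodic
    -- The constant sequence `u` is an admissible approximation, so the time regularity established
    -- for generalized solutions is available here.
    have hcl := hcs.isClosureSolution
    have hreg := timeReg_extend ha ha_ne ha_diff hf hext hres hcs.boundary hcl
    rw [contDiffOn_infty]
    intro n
    refine (contDiffOn_of_charSol hρ (fun j => ?_) (fun j n => hreg n j)
      (h := source f u) (fun j n => (hf j).partialFamily.timeReg (hreg n) 0 0)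
      (charSol_of_closure ha ha_ne hf hext hcl) (fun n hv j => ?_) n j).congr
      fun p hp => (extend_eq hp).symm
    · exact ((contDiffOn_const (c := (1 : ℝ))).div (has j) (ha_ne j)).congr fun x hx => by
        rw [invSpeed, clamp_of_mem hx]; rfl
    · have hjet : ContDiffOn ℝ n (jet (extend u)) strip :=
        contDiffOn_snd.prodMk ((hv 0).prodMk (hv 1))
      refine (((hfs j).of_le (by exact_mod_cast le_top)).comp hjet
        fun p hp => ⟨hp.2, mem_univ _⟩).congr fun p hp => ?_
      rw [source_eq hp]
      simp only [Function.comp, jet, extend_eq hp]
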